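/- Let $m=(m_0,m_1,\dots)$ be a bounded sequence of integers $m_k\ge 2$, let $G_m=\prod_{k\ge 0}\mathbb{Z}/m_k$ be the corresponding (bounded) Vilenkin group, and let $\mu$ be its normalized Haar measure, i.e. the product of the uniform probability measures. Put $M_0=1$, $M_{k+1}=m_kM_k$, write $n=\sum_k n_kM_k$ with $0\le n_k<m_k$, and let $\psi_n(x)=\prod_k \exp(2\pi i\,n_kx_k/m_k)$ be the Vilenkin functions. Let $\mathcal F_n$ be the $\sigma$-algebra generated by the sets $I_n(x)=\{y: y_0=x_0,\dots,y_{n-1}=x_{n-1}\}$, $x\in G_m$. For $0<p<\infty$, the Hardy space $H_p(G_m)$ consists of the complex martingales $f=(f^{(n)})_{n\ge0}$ with respect to $(\mathcal F_n)$ for which $$\|f\|_{H_p}:=\Big(\int_{G_m}\big(\sup_{n}|f^{(n)}|\big)^p\,d\mu\Big)^{1/p}<\infty ;$$ an integrable function $g$ is identified with the martingale $(E[g\mid\mathcal F_n])_{n\ge0}$. For a martingale $f$ let $$\hat f(i)=\lim_{k\to\infty}\int_{G_m} f^{(k)}\overline{\psi_i}\,d\mu,\qquad S_nf=\sum_{k=0}^{n-1}\hat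 f(k)\psi_k,\qquad R_nf=\frac1{l_n}\sum_{k=1}^{n-1}\frac{S_kf}{k},\qquad l_n=\sum_{k=1}^{n-1}\frac1k ,$$ so that $R_nf$, $n\ge 2$, are the Riesz logarithmic means of the Vilenkin-Fourier series of $f$ (the term $n=1$ of the sum below is $0$, as $\log 1=0$). Theorem. Let $0<p<1/2$ and let $B$ be a positive integer. There is a constant $c_p$, depending only on $p$ and on $B$, such that for every sequence $m$ of integers with $2\le m_k\le B$ for all $k$ and every $f\in H_p(G_m)$, $$\sum_{n=1}^{\infty}\frac{\log^p n\,\|R_nf\|_{H_p}^p}{n^{2-2p}}\le c_p\,\|f\|_{H_p}^p .$$ -/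

import Mathlib

open MeasureTheory ProbabilityTheory Filter Topology
open scoped ENNReal NNReal ComplexConjugate

noncomputable section

namespace Vilenkin

/-- The Vilenkin group `G_m`: the complete direct product of the cyclic groups `ℤ/m_k`, with the
product group structure and product σ-algebra. -/
abbrev Group (m : ℕ → ℕ) : Type := ∀ k, ZMod (m k)

/-- The direct product of the uniform probability measures on `ℤ/m_k`
(for `m_k ≥ 2` this is the normalized Haar measure of `G_m`). -/
def haar (m : ℕ → ℕ) : Measure (Group m) :=
  Measure.infinitePi fun k => uniformOn (Set.univ : Set (ZMod (m k)))

/-- The interval `I_n(x) = {y : y_0 = x_0, …, y_{n-1} = x_{n-1}}`. -/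
def interval (m : ℕ → ℕ) (n : ℕ) (x : Group m) : Set (Group m) :=
  {y | ∀ k < n, y k = x k}

theorem measurableSet_interval (m : ℕ → ℕ) (n : ℕ) (x : Group m) :
    MeasurableSet (interval m n x) := by
  have h : interval m n x = ⋂ k ∈ Set.Iio n, (fun y : Group m => y k) ⁻¹' {x k} := by
    ext y; simp [interval]
  rw [h]
  exact MeasurableSet.biInter (Set.to_countable _)
    fun k _ => measurable_pi_apply k (measurableSet_singleton _)

theorem interval_eq_iUnion (m : ℕ → ℕ) (n : ℕ) (x : Group m) :
    interval m n x = ⋃ z : ZMod (m n), interval m (n + 1) (Function.update x n z) := by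
  ext y
  simp only [interval, Set.mem_ofPred_eq, Set.mem_iUnion]
  constructor
  · intro h
    refine ⟨y n, fun k hk => ?_⟩
    rcases eq_or_ne k n with rfl | hne
    · simp
    · rw [Function.update_of_ne hne]
      exact h k (by omega)
  · rintro ⟨z, h⟩ k hk
    have := h k (by omega)
    rwa [Function.update_of_ne (by omega)] at this

/-- The filtration whose `n`-th σ-algebra is generated by the intervals `I_n(x)`, `x ∈ G_m`. -/
def filtration (m : ℕ → ℕ) : Filtration ℕ (inferInstance : MeasurableSpace (Group m)) where
  seq n := MeasurableSpace.generateFrom (Set.range (interval m n))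
  mono' := by
    refine monotone_nat_of_le_succ fun n => MeasurableSpace.generateFrom_le ?_
    rintro _ ⟨x, rfl⟩
    rw [interval_eq_iUnion]
    have : Countable (ZMod (m n)) := by
      cases m n with
      | zero => exact inferInstanceAs (Countable ℤ)
      | succ k => exact inferInstanceAs (Countable (Fin (k + 1)))
    exact @MeasurableSet.iUnion _ _
      (MeasurableSpace.generateFrom (Set.range (interval m (n + 1)))) _ _ fun z =>
        MeasurableSpace.measurableSet_generateFrom ⟨_, rfl⟩
  le' n := by
    refine MeasurableSpace.generateFrom_le ?_
    rintro _ ⟨x, rfl⟩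
    exact measurableSet_interval m n x

/-- The generalized number system: `M_0 = 1`, `M_{k+1} = m_k M_k`. -/
def M (m : ℕ → ℕ) (k : ℕ) : ℕ := ∏ j ∈ Finset.range k, m j

/-- The digit `n_k ∈ {0, …, m_k - 1}` in the expansion `n = ∑ n_k M_k`. -/
def digit (m : ℕ → ℕ) (n k : ℕ) : ℕ := n / M m k % m k

/-- The generalized Rademacher function `r_k(x) = exp(2 π i x_k / m_k)`. -/
def rademacher (m : ℕ → ℕ) (k : ℕ) (x : Group m) : ℂ :=
  Complex.exp (2 * Real.pi * Complex.I * ((x k).val : ℂ) / (m k : ℂ))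

/-- The Vilenkin function `ψ_n = ∏_k r_k ^ n_k`. Only the indices `k < n` can contribute, see
`digit_eq_zero`. -/
def psi (m : ℕ → ℕ) (n : ℕ) (x : Group m) : ℂ :=
  ∏ k ∈ Finset.range n, rademacher m k x ^ digit m n k

theorem digit_eq_zero {m : ℕ → ℕ} (hm : ∀ k, 2 ≤ m k) {n k : ℕ} (h : n ≤ k) :
    digit m n k = 0 := by
  have h1 : n < M m k := calc
    n ≤ k := h
    _ < 2 ^ k := Nat.lt_two_pow_self
    _ = ∏ _j ∈ Finset.range k, 2 := by simp
    _ ≤ M m k := Finset.prod_le_prod' fun j _ => hm j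
  simp [digit, Nat.div_eq_of_lt h1]

/-- The Vilenkin-Fourier coefficient of a martingale,
`lim_k ∫ f^(k) conj(ψ_i) dμ` (the sequence is eventually constant for a martingale). -/
def coeff {m : ℕ → ℕ} (f : ℕ → Group m → ℂ) (i : ℕ) : ℂ :=
  limUnder atTop fun k => ∫ x, f k x * conj (psi m i x) ∂(haar m)

/-- The partial sum `S_n f = ∑_{k < n} f̂(k) ψ_k`. -/
def partialSum {m : ℕ → ℕ} (f : ℕ → Group m → ℂ) (n : ℕ) (x : Group m) : ℂ :=
  ∑ k ∈ Finset.range n, coeff f k * psi m k x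

/-- `l_n = ∑_{k=1}^{n-1} 1/k`. -/
def l (n : ℕ) : ℝ := ∑ k ∈ Finset.Ico 1 n, 1 / (k : ℝ)

/-- The Riesz logarithmic mean `R_n f = (1/l_n) ∑_{k=1}^{n-1} S_k f / k`. -/
def rieszMean {m : ℕ → ℕ} (f : ℕ → Group m → ℂ) (n : ℕ) (x : Group m) : ℂ :=
  1 / (l n : ℂ) * ∑ k ∈ Finset.Ico 1 n, partialSum f k x / (k : ℂ)

/-- The regular martingale `(E_n g)_n` of a function `g`. -/
def regular {m : ℕ → ℕ} (g : Group m → ℂ) : ℕ → Group m → ℂ :=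
  fun n => (haar m)[g | filtration m n]

/-- The `H_p` quasi-norm of a martingale: the `L_p` quasi-norm of its maximal function
`f^* = sup_n |f^(n)|`. -/
def hardyNorm {m : ℕ → ℕ} (p : ℝ) (f : ℕ → Group m → ℂ) : ℝ≥0∞ :=
  eLpNorm (fun x => ⨆ n, ‖f n x‖ₑ) (ENNReal.ofReal p) (haar m)

/-- The martingale Hardy space `H_p(G_m)`. -/
def MemHardy {m : ℕ → ℕ} (p : ℝ) (f : ℕ → Group m → ℂ) : Prop :=
  Martingale f (filtration m) (haar m) ∧ hardyNorm p f < ∞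

end Vilenkin

end

noncomputable section

namespace Vilenkin

section Measure

variable {m : ℕ → ℕ}

/-! ### Intervals, level functions and the Haar measure -/

/-! Since `log n ≤ l n`, the factor `log^p n` is absorbed by the normalization of the Riesz mean,
and the unnormalized sums `rieszSum n f = ∑_{j<n} S_j f / j` remain. The conditional expectation of
such a sum at level `k` replaces `S_j f` by `S_{min(j, M_k)} f`. It is therefore either the sum
itself, or `rieszSum M_k f` plus `f^(k)` times a number at most `l n`. Hence the maximal function of
`R_n f` is at most `f^*` plus `(l n)⁻¹` times the sum of `|rieszSum n f|` and all `|rieszSum M_j f|`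
with `M_j ≤ n` (`norm_regular_rieszMean_le`). The `f^*` part is summable because `2 - 2p > 1`.

For the Riesz sums, `p`-subadditivity and an atomic decomposition reduce the bound to an atom `a` of
height `A` on an interval `I = I_N(y)`. On `I`, Parseval gives an `L²` bound. Off `I`, the Dirichlet
kernel `D_{M_N}(x - y)` vanishes, so only the last incomplete block of `S_j a` survives. Abel
summation against `1/j` then leaves sums `∑_{i<S} D_i`, `S ≤ M_N`. These are at most `2 M_{k+1}
M_{l+1}`, where `k < l` are the first two coordinates in which `x` and `y` differ, with `l = N` if
there is only one below `N` (`exists_norm_fejer_le`). The points agreeing with `y` below `l` except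
at `k` have measure at most `m_k / M_l`, so the `p`-th powers are controlled by `∑ l M_l^{2p-1}`,
finite exactly because `p < 1/2`. With `δ = (1 - 2p)/2` this yields `∫ |rieszSum n a|^p ≤ C A^p |I|
(n^δ + 1_{M_N ≤ n} M_N^δ n^δ)`, and summing against `n^{2p-2} = n^{-1-2δ}` gives `C A^p |I|`
uniformly in `N`.

The atoms come from stopping `f` one step before it exceeds the levels `t_i = t_0 2^i`. The
intervals where it stops at level `t_i` have total measure at most `B μ(f^* > t_i)`, and `∑ t_i^p
μ(f^* > t_i)` is bounded by a multiple of `∫ (f^*)^p`. -/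

theorem mem_interval {n : ℕ} {x y : Group m} : y ∈ interval m n x ↔ ∀ k < n, y k = x k :=
  Iff.rfl

theorem mem_interval_self (n : ℕ) (x : Group m) : x ∈ interval m n x := fun _ _ => rfl

theorem mem_interval_comm {n : ℕ} {x y : Group m} : y ∈ interval m n x ↔ x ∈ interval m n y :=
  ⟨fun h k hk => (h k hk).symm, fun h k hk => (h k hk).symm⟩

theorem interval_eq_of_mem {n : ℕ} {x y : Group m} (h : y ∈ interval m n x) :
    interval m n y = interval m n x := by
  ext z
  exact ⟨fun hz k hk => (hz k hk).trans (h k hk), fun hz k hk => (hz k hk).trans (h k hk).symm⟩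

theorem interval_anti {n k : ℕ} (h : n ≤ k) (x : Group m) : interval m k x ⊆ interval m n x :=
  fun _ hy j hj => hy j (hj.trans_le h)

theorem interval_zero (x : Group m) : interval m 0 x = Set.univ := by
  ext; simp [interval]

/-- `g` depends on the first `n` coordinates only. -/
def IsLevel {α : Type*} (n : ℕ) (g : Group m → α) : Prop :=
  ∀ x y, y ∈ interval m n x → g y = g x

theorem IsLevel.mono {α : Type*} {n k : ℕ} {g : Group m → α} (h : IsLevel n g) (hnk : n ≤ k) :
    IsLevel k g :=
  fun x y hy => h x y (interval_anti hnk x hy)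

theorem IsLevel.comp {α β : Type*} {n : ℕ} {g : Group m → α} (h : IsLevel n g) (φ : α → β) :
    IsLevel n fun x => φ (g x) :=
  fun x y hy => congrArg φ (h x y hy)

theorem IsLevel.comp₂ {α β γ : Type*} {n : ℕ} {g : Group m → α} {h : Group m → β}
    (hg : IsLevel n g) (hh : IsLevel n h) (φ : α → β → γ) : IsLevel n fun x => φ (g x) (h x) :=
  fun x y hy => congrArg₂ φ (hg x y hy) (hh x y hy)

theorem isLevel_const {α : Type*} (n : ℕ) (c : α) : IsLevel (m := m) n fun _ => c :=
  fun _ _ _ => rfl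

theorem IsLevel.sum {ι : Type*} {n : ℕ} {g : ι → Group m → ℂ} {s : Finset ι}
    (h : ∀ i ∈ s, IsLevel n (g i)) : IsLevel n fun x => ∑ i ∈ s, g i x :=
  fun x y hy => Finset.sum_congr rfl fun i hi => h i hi x y hy

theorem isLevel_mem_interval (n : ℕ) (x : Group m) : IsLevel n fun y => y ∈ interval m n x := by
  intro a b hab
  simp only [eq_iff_iff]
  exact ⟨fun h k hk => (hab k hk).symm.trans (h k hk), fun h k hk => (hab k hk).trans (h k hk)⟩

theorem isLevel_indicator {n : ℕ} {S : Set (Group m)} {g : Group m → ℂ}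
    (hS : IsLevel n fun x => x ∈ S) (hg : IsLevel n g) : IsLevel n (S.indicator g) := by
  classical
  intro x y hy
  have h1 : (y ∈ S) = (x ∈ S) := hS x y hy
  simp only [Set.indicator_apply, h1, hg x y hy]

/-- The point with the same first `n` coordinates as `x`, and all others `0`. -/
def truncate (n : ℕ) (x : Group m) : Group m := fun k => if k < n then x k else 0

theorem truncate_mem_interval (n : ℕ) (x : Group m) : truncate n x ∈ interval m n x := by
  intro k hk
  simp [truncate, hk]

theorem truncate_eq_of_mem {n : ℕ} {x y : Group m} (h : y ∈ interval m n x) :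
    truncate n y = truncate n x := by
  funext k
  by_cases hk : k < n
  · simp [truncate, hk, h k hk]
  · simp [truncate, hk]

variable [∀ k, NeZero (m k)]

theorem finite_range_truncate (n : ℕ) : (Set.range (truncate (m := m) n)).Finite := by
  have : Set.range (truncate (m := m) n) ⊆
      Set.range fun (u : ∀ k : Fin n, ZMod (m k)) (k : ℕ) =>
        if h : k < n then u ⟨k, h⟩ else (0 : ZMod (m k)) := by
    rintro _ ⟨x, rfl⟩
    refine ⟨fun k => x k, ?_⟩
    funext k
    by_cases hk : k < n <;> simp [truncate, hk]
  exact (Set.finite_range _).subset this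

/-- Representatives of the intervals of level `n`. -/
def reps (m : ℕ → ℕ) [∀ k, NeZero (m k)] (n : ℕ) : Finset (Group m) :=
  (finite_range_truncate (m := m) n).toFinset

theorem truncate_mem_reps (n : ℕ) (x : Group m) : truncate n x ∈ reps m n := by
  simp [reps]

theorem eq_truncate_of_mem_reps {n : ℕ} {r x : Group m} (hr : r ∈ reps m n)
    (hx : x ∈ interval m n r) : r = truncate n x := by
  simp only [reps, Set.Finite.mem_toFinset, Set.mem_range] at hr
  obtain ⟨z, rfl⟩ := hr
  rw [truncate_eq_of_mem hx]
  funext k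
  by_cases hk : k < n <;> simp [truncate, hk]

theorem IsLevel.finite_range {α : Type*} {n : ℕ} {g : Group m → α} (h : IsLevel n g) :
    (Set.range g).Finite := by
  refine ((reps m n).finite_toSet.image g).subset ?_
  rintro _ ⟨x, rfl⟩
  exact ⟨truncate n x, truncate_mem_reps n x, h _ _ (truncate_mem_interval n x)⟩

/-- Only finitely many intervals of level `n` exist, one for each truncated point, so such a set is
a finite union of generators. -/
theorem IsLevel.measurableSet_filtration {n : ℕ} {S : Set (Group m)}
    (h : IsLevel n fun x => x ∈ S) : MeasurableSet[filtration m n] S := by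
  have : S = ⋃ r ∈ {r | r ∈ reps m n ∧ r ∈ S}, interval m n r := by
    ext x
    simp only [Set.mem_iUnion, Set.mem_ofPred_eq, exists_prop]
    constructor
    · intro hx
      have h1 := h _ _ (truncate_mem_interval n x)
      exact ⟨truncate n x, ⟨truncate_mem_reps n x, h1.mpr hx⟩,
        mem_interval_comm.1 (truncate_mem_interval n x)⟩
    · rintro ⟨r, ⟨-, hr⟩, hx⟩
      exact (h _ _ hx).mpr hr
  rw [this]
  refine @MeasurableSet.biUnion _ _ (filtration m n) _ _
    (((reps m n).finite_toSet.subset fun r hr => hr.1).countable) fun r _ => ?_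
  exact MeasurableSpace.measurableSet_generateFrom ⟨r, rfl⟩

theorem IsLevel.measurableSet {n : ℕ} {S : Set (Group m)}
    (h : IsLevel n fun x => x ∈ S) : MeasurableSet S :=
  (filtration m).le n _ h.measurableSet_filtration

theorem IsLevel.measurable {α : Type*} [MeasurableSpace α] {n : ℕ} {g : Group m → α}
    (h : IsLevel n g) : Measurable g :=
  fun s _ => IsLevel.measurableSet (n := n) fun x y hy => by simp [h x y hy]

theorem IsLevel.exists_norm_le {E : Type*} [NormedAddCommGroup E] {n : ℕ} {g : Group m → E} (h : IsLevel n g) :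
    ∃ C : ℝ, ∀ x, ‖g x‖ ≤ C := by
  obtain ⟨C, hC⟩ := (h.finite_range.image norm).bddAbove
  exact ⟨C, fun x => hC ⟨g x, ⟨x, rfl⟩, rfl⟩⟩

omit [∀ k, NeZero (m k)] in
-- Being a union of intervals of level `n` is preserved by complements and countable unions. With
-- the converse above, measurability becomes a pointwise condition, and identities for conditional
-- expectations hold everywhere.
theorem isLevel_of_measurableSet_filtration {n : ℕ} {S : Set (Group m)}
    (h : MeasurableSet[filtration m n] S) : IsLevel n fun x => x ∈ S := by
  refine MeasurableSpace.generateFrom_induction (C := Set.range (interval m n))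
    (fun S _ => IsLevel n fun x => x ∈ S) ?_ ?_ ?_ ?_ S h
  · rintro _ ⟨x, rfl⟩ _
    exact isLevel_mem_interval n x
  · exact isLevel_const n False
  · intro S _ hS x y hy
    have := hS x y hy
    simp only [Set.mem_compl_iff, this]
  · intro S _ hS x y hy
    simp only [Set.mem_iUnion, eq_iff_iff]
    exact exists_congr fun i => iff_of_eq (hS i x y hy)

omit [∀ k, NeZero (m k)] in
theorem isLevel_of_stronglyMeasurable {n : ℕ} {g : Group m → ℂ}
    (h : StronglyMeasurable[filtration m n] g) : IsLevel n g := by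
  intro x y hy
  have h1 : MeasurableSet[filtration m n] (g ⁻¹' {g x}) :=
    h.measurable (measurableSet_singleton _)
  have h2 := isLevel_of_measurableSet_filtration h1 x y hy
  have h3 : y ∈ g ⁻¹' {g x} := h2.mpr rfl
  exact h3

/-! ### Haar measure of intervals and its translation invariance. -/

instance isProbabilityMeasure_uniformOn_zmod (N : ℕ) [NeZero N] :
    IsProbabilityMeasure (uniformOn (Set.univ : Set (ZMod N))) :=
  isProbabilityMeasure_uniformOn Set.finite_univ ⟨0, trivial⟩

instance isProbabilityMeasure_haar : IsProbabilityMeasure (haar m) := by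
  unfold haar; infer_instance

theorem IsLevel.integrable {E : Type*} [NormedAddCommGroup E] [SecondCountableTopology E] {n : ℕ}
    {g : Group m → E} (h : IsLevel n g) : Integrable g (haar m) := by
  borelize E
  obtain ⟨C, hC⟩ := h.exists_norm_le
  exact Integrable.of_bound h.measurable.aestronglyMeasurable C (Eventually.of_forall hC)

theorem uniformOn_univ_singleton (N : ℕ) [NeZero N] (a : ZMod N) :
    uniformOn (Set.univ : Set (ZMod N)) {a} = (N : ℝ≥0∞)⁻¹ := by
  rw [uniformOn_univ, Measure.count_singleton, ZMod.card, one_div]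

theorem haar_interval (n : ℕ) (x : Group m) : haar m (interval m n x) = (M m n : ℝ≥0∞)⁻¹ := by
  have h : interval m n x = (↑(Finset.range n) : Set ℕ).pi fun k => {x k} := by
    ext y; simp [interval, Set.mem_pi]
  rw [h, haar, Measure.infinitePi_pi _ fun i _ => measurableSet_singleton _]
  simp only [uniformOn_univ_singleton, M]
  rw [Nat.cast_prod, ENNReal.prod_inv_distrib]
  intro i _ j _ _
  simp

theorem haar_real_interval (n : ℕ) (x : Group m) :
    (haar m).real (interval m n x) = (M m n : ℝ)⁻¹ := by
  simp [Measure.real, haar_interval]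

/-- Serves the orthogonality of the `psi`, which is proved by translating one coordinate. -/
theorem measurePreserving_add_right (e : Group m) :
    MeasurePreserving (fun x : Group m => x + e) (haar m) (haar m) := by
  have hm : ∀ k, Measurable fun z : ZMod (m k) => z + e k := fun k => Measurable.of_discrete
  refine ⟨measurable_pi_lambda _ fun k => (hm k).comp (measurable_pi_apply k), ?_⟩
  have h := Measure.infinitePi_map_pi (fun k => uniformOn (Set.univ : Set (ZMod (m k)))) hm
  refine h.trans ?_
  unfold haar
  congr 1
  funext k
  ext s hs
  rw [Measure.map_apply (hm k) hs, uniformOn_univ, uniformOn_univ]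
  congr 1
  have h2 : (fun z : ZMod (m k) => z + e k) ⁻¹' s = (Equiv.addRight (e k)).symm '' s := by
    rw [Equiv.image_symm_eq_preimage]; rfl
  rw [h2, Measure.count_injective_image (Equiv.injective _)]

theorem measurableEmbedding_add_right (e : Group m) :
    MeasurableEmbedding fun x : Group m => x + e := by
  refine (MeasurableEquiv.mk (Equiv.addRight e) ?_ ?_).measurableEmbedding
  · exact (measurePreserving_add_right e).measurable
  · have := (measurePreserving_add_right (-e)).measurable
    exact this

theorem setIntegral_interval {n : ℕ} {g : Group m → ℂ} (h : IsLevel n g) (x : Group m) :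
    ∫ y in interval m n x, g y ∂haar m = (M m n : ℂ)⁻¹ * g x := by
  rw [setIntegral_congr_fun (g := fun _ => g x) (measurableSet_interval m n x)
    fun y hy => h x y hy, setIntegral_const, haar_real_interval]
  simp

omit [∀ k, NeZero (m k)] in
theorem M_succ (k : ℕ) : M m (k + 1) = M m k * m k := Finset.prod_range_succ _ _

theorem M_pos (k : ℕ) : 0 < M m k := Finset.prod_pos fun j _ => NeZero.pos (m j)

omit [∀ k, NeZero (m k)] in
theorem M_dvd {j k : ℕ} (h : j ≤ k) : M m j ∣ M m k :=
  Finset.prod_dvd_prod_of_subset _ _ _ (Finset.range_mono h)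

theorem M_mono {j k : ℕ} (h : j ≤ k) : M m j ≤ M m k := Nat.le_of_dvd (M_pos k) (M_dvd h)

end Measure

/-! ### Dirichlet and Fejér kernels of a sequence of roots of unity -/

section Kernels

variable {m : ℕ → ℕ}

theorem two_pow_le_M (hm : ∀ k, 2 ≤ m k) (n : ℕ) : 2 ^ n ≤ M m n := calc
  2 ^ n = ∏ _j ∈ Finset.range n, 2 := by simp
  _ ≤ M m n := Finset.prod_le_prod' fun j _ => hm j

theorem lt_M (hm : ∀ k, 2 ≤ m k) (n : ℕ) : n < M m n :=
  Nat.lt_two_pow_self.trans_le (two_pow_le_M hm n)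

theorem digit_of_lt_M {n k : ℕ} (h : n < M m k) : digit m n k = 0 := by
  simp [digit, Nat.div_eq_of_lt h]

/-- Adding `s < M_N` to a multiple of `M_N` causes no carry: digits below `N` come from `s`, the
others from the multiple. -/
theorem digit_mul_add_of_lt [∀ k, NeZero (m k)] {q s N k : ℕ} (hk : k < N) :
    digit m (q * M m N + s) k = digit m s k := by
  obtain ⟨c, hc⟩ := M_dvd (m := m) (Nat.succ_le_of_lt hk)
  rw [Nat.succ_eq_add_one, M_succ] at hc
  have h : q * M m N + s = s + M m k * (m k * (c * q)) := by rw [hc]; ring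
  rw [digit, digit, h, Nat.add_mul_div_left _ _ (M_pos k), Nat.add_mul_mod_self_left]

theorem digit_mul_add_of_le [∀ k, NeZero (m k)] {q s N k : ℕ} (hk : N ≤ k) (hs : s < M m N) :
    digit m (q * M m N + s) k = digit m (q * M m N) k := by
  obtain ⟨c, hc⟩ := M_dvd (m := m) hk
  have h1 : (q * M m N + s) / M m k = q / c := by
    rw [hc, ← Nat.div_div_eq_div_mul, add_comm, Nat.add_mul_div_right _ _ (M_pos N),
      Nat.div_eq_of_lt hs, zero_add]
  have h2 : (q * M m N) / M m k = q / c := by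
    rw [hc, ← Nat.div_div_eq_div_mul, Nat.mul_div_cancel _ (M_pos N)]
  rw [digit, digit, h1, h2]

theorem digit_mul_of_lt [∀ k, NeZero (m k)] {q N k : ℕ} (hk : k < N) :
    digit m (q * M m N) k = 0 := by
  have := digit_mul_add_of_lt (m := m) (q := q) (s := 0) hk
  rw [add_zero] at this
  rw [this]
  simp [digit]

/-- The character `∏ ζ_k ^ n_k`. -/
def chi (m : ℕ → ℕ) (ζ : ℕ → ℂ) (n : ℕ) : ℂ := ∏ k ∈ Finset.range n, ζ k ^ digit m n k

variable {ζ : ℕ → ℂ}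

theorem chi_eq_of_lt_M (hm : ∀ k, 2 ≤ m k) {n K : ℕ} (h : n < M m K) :
    chi m ζ n = ∏ k ∈ Finset.range K, ζ k ^ digit m n k := by
  have : ∀ k, NeZero (m k) := fun k => ⟨by have := hm k; omega⟩
  have key : ∀ {a b : ℕ}, a ≤ b → (∀ k, a ≤ k → digit m n k = 0) →
      ∏ k ∈ Finset.range a, ζ k ^ digit m n k = ∏ k ∈ Finset.range b, ζ k ^ digit m n k := by
    intro a b hab h0
    refine Finset.prod_subset (Finset.range_mono hab) fun k _ hk => ?_
    rw [h0 k (by simpa using hk), pow_zero]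
  rcases le_total n K with hnK | hnK
  · exact key hnK fun k hk => digit_eq_zero hm hk
  · exact (key hnK fun k hk => digit_of_lt_M (h.trans_le (M_mono hk))).symm

theorem chi_mul_add (hm : ∀ k, 2 ≤ m k) {q s N : ℕ} (hs : s < M m N) :
    chi m ζ (q * M m N + s) = chi m ζ (q * M m N) * chi m ζ s := by
  have : ∀ k, NeZero (m k) := fun k => ⟨by have := hm k; omega⟩
  have h0 := lt_M hm (q * M m N + s)
  rw [chi_eq_of_lt_M hm h0, chi_eq_of_lt_M hm ((Nat.le_add_right _ s).trans_lt h0),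
    chi_eq_of_lt_M hm ((Nat.le_add_left _ (q * M m N)).trans_lt h0), ← Finset.prod_mul_distrib]
  refine Finset.prod_congr rfl fun k _ => ?_
  rcases lt_or_ge k N with hk | hk
  · rw [digit_mul_add_of_lt hk, digit_mul_of_lt hk, pow_zero, one_mul]
  · rw [digit_mul_add_of_le hk hs, digit_of_lt_M (hs.trans_le (M_mono hk)), pow_zero, mul_one]

theorem chi_mul_M (hm : ∀ k, 2 ≤ m k) {b N : ℕ} (hb : b < m N) :
    chi m ζ (b * M m N) = ζ N ^ b := by
  have : ∀ k, NeZero (m k) := fun k => ⟨by have := hm k; omega⟩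
  have h : b * M m N < M m (N + 1) := by
    rw [M_succ, mul_comm]; exact Nat.mul_lt_mul_of_pos_left hb (M_pos N)
  rw [chi_eq_of_lt_M hm h, Finset.prod_range_succ, Finset.prod_eq_one, one_mul]
  · rw [digit, Nat.mul_div_cancel _ (M_pos N), Nat.mod_eq_of_lt hb]
  · intro k hk
    rw [digit_mul_of_lt (Finset.mem_range.1 hk), pow_zero]

theorem chi_congr (hm : ∀ k, 2 ≤ m k) {ζ' : ℕ → ℂ} {N s : ℕ} (hs : s < M m N)
    (h : ∀ k < N, ζ k = ζ' k) : chi m ζ s = chi m ζ' s := by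
  rw [chi_eq_of_lt_M hm hs, chi_eq_of_lt_M hm hs]
  exact Finset.prod_congr rfl fun k hk => by rw [h k (Finset.mem_range.1 hk)]

/-- Digits of a multiple of `M_N` vanish below `N`. This makes it harmless to replace the roots
below `N` by `1` in `norm_blockDirichlet_le`. -/
theorem chi_mul_congr (hm : ∀ k, 2 ≤ m k) {ζ' : ℕ → ℂ} {N q : ℕ}
    (h : ∀ k, N ≤ k → ζ k = ζ' k) : chi m ζ (q * M m N) = chi m ζ' (q * M m N) := by
  have : ∀ k, NeZero (m k) := fun k => ⟨by have := hm k; omega⟩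
  refine Finset.prod_congr rfl fun k _ => ?_
  rcases lt_or_ge k N with hk | hk
  · rw [digit_mul_of_lt hk, pow_zero, pow_zero]
  · rw [h k hk]

theorem norm_chi (hζ : ∀ k, ‖ζ k‖ = 1) (n : ℕ) : ‖chi m ζ n‖ = 1 := by
  simp [chi, norm_prod, hζ]

/-- The Dirichlet kernel `∑_{i < n} χ_i`. -/
def dirichlet (m : ℕ → ℕ) (ζ : ℕ → ℂ) (n : ℕ) : ℂ := ∑ i ∈ Finset.range n, chi m ζ i

/-- The sum `∑_{i < n} D_i` of Dirichlet kernels, i.e. `n` times the Fejér kernel. -/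
def fejer (m : ℕ → ℕ) (ζ : ℕ → ℂ) (n : ℕ) : ℂ := ∑ i ∈ Finset.range n, dirichlet m ζ i

/-- The Dirichlet kernel of the characters of index divisible by `M_N`. -/
def blockDirichlet (m : ℕ → ℕ) (ζ : ℕ → ℂ) (N q : ℕ) : ℂ :=
  ∑ b ∈ Finset.range q, chi m ζ (b * M m N)

theorem sum_range_mul_add {α : Type*} [AddCommMonoid α] (h : ℕ → α) (q L s : ℕ) :
    ∑ i ∈ Finset.range (q * L + s), h i =
      ∑ b ∈ Finset.range q, ∑ j ∈ Finset.range L, h (b * L + j) +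
        ∑ j ∈ Finset.range s, h (q * L + j) := by
  rw [Finset.sum_range_add]
  congr 1
  induction q with
  | zero => simp
  | succ q ih => rw [add_mul, one_mul, Finset.sum_range_add, ih, Finset.sum_range_succ]

/-- In blocks of length `M_N` the character factors through `chi_mul_add`, so every complete block
carries the factor `D_{M_N}`. -/
theorem dirichlet_mul_add (hm : ∀ k, 2 ≤ m k) {q s N : ℕ} (hs : s ≤ M m N) :
    dirichlet m ζ (q * M m N + s) =
      blockDirichlet m ζ N q * dirichlet m ζ (M m N) + chi m ζ (q * M m N) * dirichlet m ζ s := by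
  rw [dirichlet, sum_range_mul_add, blockDirichlet, dirichlet, dirichlet, Finset.sum_mul,
    Finset.mul_sum]
  congr 1
  · refine Finset.sum_congr rfl fun b _ => ?_
    rw [Finset.mul_sum]
    exact Finset.sum_congr rfl fun j hj => chi_mul_add hm (Finset.mem_range.1 hj)
  · exact Finset.sum_congr rfl fun j hj => chi_mul_add hm ((Finset.mem_range.1 hj).trans_le hs)

theorem dirichlet_zero : dirichlet m ζ 0 = 0 := by simp [dirichlet]

theorem dirichlet_M_succ (hm : ∀ k, 2 ≤ m k) (N : ℕ) :
    dirichlet m ζ (M m (N + 1)) = (∑ b ∈ Finset.range (m N), ζ N ^ b) * dirichlet m ζ (M m N) := by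
  have h := dirichlet_mul_add (ζ := ζ) hm (q := m N) (Nat.zero_le (M m N))
  rw [add_zero, mul_comm (m N), ← M_succ, dirichlet_zero, mul_zero, add_zero] at h
  rw [h, blockDirichlet]
  congr 1
  exact Finset.sum_congr rfl fun b hb => chi_mul_M hm (Finset.mem_range.1 hb)

/-- `D_{M_N}` is the product over `k < N` of the geometric sums `∑_{b<m_k} ζ_k^b`, and the factor of
a nontrivial root of unity is zero. -/
theorem dirichlet_M_eq_zero (hm : ∀ k, 2 ≤ m k) (hζ : ∀ k, ζ k ^ m k = 1) {k N : ℕ} (hk : k < N)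
    (hne : ζ k ≠ 1) : dirichlet m ζ (M m N) = 0 := by
  induction N with
  | zero => omega
  | succ N ih =>
    rw [dirichlet_M_succ hm]
    rcases Nat.lt_succ_iff_lt_or_eq.1 hk with h | rfl
    · rw [ih h, mul_zero]
    · have : (∑ b ∈ Finset.range (m k), ζ k ^ b) * (ζ k - 1) = 0 := by
        rw [geom_sum_mul, hζ, sub_self]
      rw [(mul_eq_zero.1 this).resolve_right (sub_ne_zero.2 hne), zero_mul]

theorem dirichlet_M_of_eq_one (hm : ∀ k, 2 ≤ m k) {N : ℕ} (h : ∀ k < N, ζ k = 1) :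
    dirichlet m ζ (M m N) = M m N := by
  rw [dirichlet, Finset.sum_congr rfl fun i hi => ?_, Finset.sum_const, Finset.card_range,
    nsmul_eq_mul, mul_one]
  rw [chi_congr hm (ζ' := fun _ => 1) (Finset.mem_range.1 hi) h]
  simp [chi]

theorem norm_eq_one_of_root (hm : ∀ k, 2 ≤ m k) (hζ : ∀ k, ζ k ^ m k = 1) (k : ℕ) :
    ‖ζ k‖ = 1 :=
  Complex.norm_eq_one_of_pow_eq_one (hζ k) (by have := hm k; omega)

theorem norm_dirichlet_le (hζ : ∀ k, ‖ζ k‖ = 1) (n : ℕ) : ‖dirichlet m ζ n‖ ≤ n := by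
  refine (norm_sum_le _ _).trans ?_
  simp [norm_chi hζ]

/-- Complete blocks of length `M_{k+1}` cancel; what is left is a sum of fewer than `M_{k+1}`
unimodular terms. -/
theorem norm_dirichlet_le_M (hm : ∀ k, 2 ≤ m k) (hζ : ∀ k, ζ k ^ m k = 1) {k : ℕ}
    (hne : ζ k ≠ 1) (n : ℕ) : ‖dirichlet m ζ n‖ ≤ M m (k + 1) := by
  have hn := norm_eq_one_of_root hm hζ
  have : ∀ k, NeZero (m k) := fun k => ⟨by have := hm k; omega⟩
  have hs := (Nat.mod_lt n (M_pos (m := m) (k + 1))).le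
  conv_lhs => rw [← Nat.div_add_mod' n (M m (k + 1))]
  rw [dirichlet_mul_add hm hs, dirichlet_M_eq_zero hm hζ (Nat.lt_succ_self k) hne, mul_zero,
    zero_add, norm_mul, norm_chi hn, one_mul]
  exact (norm_dirichlet_le hn _).trans (by exact_mod_cast hs)

theorem fejer_mul_add (hm : ∀ k, 2 ≤ m k) {q s N : ℕ} (h0 : dirichlet m ζ (M m N) = 0)
    (hs : s ≤ M m N) : fejer m ζ (q * M m N + s) =
      blockDirichlet m ζ N q * fejer m ζ (M m N) + chi m ζ (q * M m N) * fejer m ζ s := by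
  rw [fejer, sum_range_mul_add, blockDirichlet, fejer, fejer, Finset.sum_mul, Finset.mul_sum]
  congr 1
  · refine Finset.sum_congr rfl fun b _ => ?_
    rw [Finset.mul_sum]
    refine Finset.sum_congr rfl fun j hj => ?_
    rw [dirichlet_mul_add hm (Finset.mem_range.1 hj).le, h0, mul_zero, zero_add]
  · refine Finset.sum_congr rfl fun j hj => ?_
    rw [dirichlet_mul_add hm ((Finset.mem_range.1 hj).le.trans hs), h0, mul_zero, zero_add]

theorem norm_fejer_le (hζ : ∀ k, ‖ζ k‖ = 1) {s L : ℕ} (hs : s ≤ L) :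
    ‖fejer m ζ s‖ ≤ (L : ℝ) * L := by
  refine (norm_sum_le _ _).trans ?_
  refine (Finset.sum_le_sum (g := fun _ => (L : ℝ)) fun i hi => ?_).trans ?_
  · refine (norm_dirichlet_le hζ i).trans ?_
    exact_mod_cast (Finset.mem_range.1 hi).le.trans hs
  · rw [Finset.sum_const, Finset.card_range, nsmul_eq_mul]
    gcongr

/-- The block kernel ignores the roots below `N`. Once these are set to `1`, `M_N` times the block
kernel is the ordinary Dirichlet kernel of index `q M_N`, to which `norm_dirichlet_le_M` applies. -/
theorem norm_blockDirichlet_le (hm : ∀ k, 2 ≤ m k) (hζ : ∀ k, ζ k ^ m k = 1) {N l : ℕ}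
    (hl : N ≤ l) (hne : ζ l ≠ 1) (q : ℕ) :
    (M m N : ℝ) * ‖blockDirichlet m ζ N q‖ ≤ M m (l + 1) := by
  let ξ : ℕ → ℂ := fun k => if k < N then 1 else ζ k
  have hξ : ∀ k, ξ k ^ m k = 1 := by
    intro k
    by_cases hk : k < N <;> simp [ξ, hk, hζ]
  have hξl : ξ l ≠ 1 := by simpa [ξ, hl.not_gt] using hne
  have h := norm_dirichlet_le_M hm hξ hξl (q * M m N + 0)
  rw [dirichlet_mul_add hm (Nat.zero_le _), dirichlet_M_of_eq_one hm fun k hk => by simp [ξ, hk],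
    dirichlet_zero, mul_zero, add_zero, norm_mul, Complex.norm_natCast, mul_comm] at h
  have h2 : blockDirichlet m ξ N q = blockDirichlet m ζ N q :=
    Finset.sum_congr rfl fun b _ => chi_mul_congr hm fun k hk => by simp [ξ, hk.not_gt]
  rwa [h2] at h

/-- Because `D_{M_{k+1}} = 0`, the sum of Dirichlet kernels splits into a block kernel times a
complete sum, plus an incomplete one. Both sums are trivially at most `M_{k+1}²`, and each product
is then at most `M_{k+1} L`. -/
theorem norm_fejer_le_of_blockDirichlet_le (hm : ∀ k, 2 ≤ m k) (hζ : ∀ k, ζ k ^ m k = 1) {k : ℕ}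
    (hk : ζ k ≠ 1) {S L : ℕ} (hL : M m (k + 1) ≤ L)
    (h : (M m (k + 1) : ℝ) * ‖blockDirichlet m ζ (k + 1) (S / M m (k + 1))‖ ≤ L) :
    ‖fejer m ζ S‖ ≤ 2 * M m (k + 1) * L := by
  have hn := norm_eq_one_of_root hm hζ
  have : ∀ k, NeZero (m k) := fun k => ⟨by have := hm k; omega⟩
  have hs := (Nat.mod_lt S (M_pos (m := m) (k + 1))).le
  conv_lhs => rw [← Nat.div_add_mod' S (M m (k + 1))]
  rw [fejer_mul_add hm (dirichlet_M_eq_zero hm hζ (Nat.lt_succ_self k) hk) hs]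
  refine (norm_add_le _ _).trans ?_
  rw [norm_mul, norm_mul, norm_chi hn, one_mul]
  have h1 := norm_fejer_le (m := m) hn (le_refl (M m (k + 1)))
  have h2 := norm_fejer_le (m := m) hn hs
  have hL' : (M m (k + 1) : ℝ) ≤ L := by exact_mod_cast hL
  have h3 : ‖blockDirichlet m ζ (k + 1) (S / M m (k + 1))‖ * ‖fejer m ζ (M m (k + 1))‖ ≤
      M m (k + 1) * L := by
    calc _ ≤ ‖blockDirichlet m ζ (k + 1) (S / M m (k + 1))‖ *
          ((M m (k + 1) : ℝ) * M m (k + 1)) := by gcongr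
      _ = M m (k + 1) * (M m (k + 1) * ‖blockDirichlet m ζ (k + 1) (S / M m (k + 1))‖) := by ring
      _ ≤ _ := by gcongr
  have h4 : (M m (k + 1) : ℝ) * M m (k + 1) ≤ M m (k + 1) * L := by gcongr
  linarith

theorem norm_fejer_le_of_two (hm : ∀ k, 2 ≤ m k) (hζ : ∀ k, ζ k ^ m k = 1) {k l : ℕ} (hkl : k < l)
    (hk : ζ k ≠ 1) (hl : ζ l ≠ 1) (S : ℕ) :
    ‖fejer m ζ S‖ ≤ 2 * M m (k + 1) * M m (l + 1) := by
  have : ∀ k, NeZero (m k) := fun k => ⟨by have := hm k; omega⟩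
  exact norm_fejer_le_of_blockDirichlet_le hm hζ hk (M_mono (by omega))
    (norm_blockDirichlet_le hm hζ hkl hl _)

/-- Without a second nontrivial root, the block kernel is estimated by its number of terms. -/
theorem norm_fejer_le_of_one (hm : ∀ k, 2 ≤ m k) (hζ : ∀ k, ζ k ^ m k = 1) {k N S : ℕ} (hkN : k < N)
    (hk : ζ k ≠ 1) (hS : S ≤ M m N) : ‖fejer m ζ S‖ ≤ 2 * M m (k + 1) * M m N := by
  have : ∀ k, NeZero (m k) := fun k => ⟨by have := hm k; omega⟩
  refine norm_fejer_le_of_blockDirichlet_le hm hζ hk (M_mono (by omega)) ?_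
  have h1 : ‖blockDirichlet m ζ (k + 1) (S / M m (k + 1))‖ ≤ (S / M m (k + 1) : ℕ) := by
    refine (norm_sum_le _ _).trans ?_
    simp [norm_chi (norm_eq_one_of_root hm hζ)]
  calc (M m (k + 1) : ℝ) * ‖blockDirichlet m ζ (k + 1) (S / M m (k + 1))‖
      ≤ M m (k + 1) * (S / M m (k + 1) : ℕ) := by gcongr
    _ ≤ S := by exact_mod_cast Nat.mul_div_le S _
    _ ≤ M m N := by exact_mod_cast hS

/-- The bound for the kernel in terms of the first two indices `k < l ≤ N` with `ζ ≠ 1`,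
where `l = N` if there is only one below `N`. -/
theorem exists_norm_fejer_le (hm : ∀ k, 2 ≤ m k) (hζ : ∀ k, ζ k ^ m k = 1) {N : ℕ}
    (h : ∃ k < N, ζ k ≠ 1) : ∃ k l, k < l ∧ l ≤ N ∧ (∀ i < l, i ≠ k → ζ i = 1) ∧
      ∀ S ≤ M m N, ‖fejer m ζ S‖ ≤ 2 * M m (k + 1) * M m (l + 1) := by
  classical
  have : ∀ k, NeZero (m k) := fun k => ⟨by have := hm k; omega⟩
  have hex : ∃ k, ζ k ≠ 1 := h.imp fun k hk => hk.2
  have hkN : Nat.find hex < N := by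
    obtain ⟨k, hk, hne⟩ := h
    exact (Nat.find_min' hex hne).trans_lt hk
  have hkne := Nat.find_spec hex
  have hkmin : ∀ i < Nat.find hex, ζ i = 1 := fun i hi => not_not.1 (Nat.find_min hex hi)
  set k := Nat.find hex with hkdef
  have hex2 : ∃ l, k < l ∧ (l = N ∨ ζ l ≠ 1) := ⟨N, hkN, Or.inl rfl⟩
  obtain ⟨hl1, hl2⟩ := Nat.find_spec hex2
  have hlN : Nat.find hex2 ≤ N := Nat.find_min' hex2 ⟨hkN, Or.inl rfl⟩
  have hlmin : ∀ i < Nat.find hex2, k < i → ζ i = 1 := by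
    intro i hi hki
    have := Nat.find_min hex2 hi
    by_contra hne
    exact this ⟨hki, Or.inr hne⟩
  set l := Nat.find hex2
  refine ⟨k, l, hl1, hlN, fun i hi hik => ?_, fun S hS => ?_⟩
  · rcases lt_or_gt_of_ne hik with h1 | h1
    · exact hkmin i h1
    · exact hlmin i hi h1
  · rcases hl2 with h2 | h2
    · refine (norm_fejer_le_of_one hm hζ hkN hkne hS).trans ?_
      have : (M m N : ℝ) ≤ M m (l + 1) := by exact_mod_cast M_mono (by omega)
      gcongr
    · exact norm_fejer_le_of_two hm hζ hl1 hkne h2 S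

/-- Abel summation. -/
theorem norm_sum_mul_le_of_antitone {d : ℕ → ℂ} {c : ℕ → ℝ} {A : ℝ} (hc : Antitone c)
    (hc0 : ∀ n, 0 ≤ c n) (S : ℕ) (hA : ∀ n ≤ S, ‖∑ i ∈ Finset.range n, d i‖ ≤ A) :
    ‖∑ i ∈ Finset.range S, d i * c i‖ ≤ c 0 * A := by
  have key : ∀ n ≤ S, ∑ i ∈ Finset.range n, d i * c i =
      c n * ∑ i ∈ Finset.range n, d i +
        ∑ i ∈ Finset.range n, ((c i - c (i + 1) : ℝ) : ℂ) * ∑ j ∈ Finset.range (i + 1), d j := by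
    intro n _
    induction n with
    | zero => simp
    | succ n ih =>
      rw [Finset.sum_range_succ, ih (by omega),
        Finset.sum_range_succ (fun i => ((c i - c (i + 1) : ℝ) : ℂ) * _),
        Finset.sum_range_succ d n]
      push_cast
      ring
  rw [key S le_rfl]
  refine (norm_add_le _ _).trans ?_
  have h1 : ‖(c S : ℂ) * ∑ i ∈ Finset.range S, d i‖ ≤ c S * A := by
    rw [norm_mul, Complex.norm_real, Real.norm_of_nonneg (hc0 S)]
    exact mul_le_mul_of_nonneg_left (hA S le_rfl) (hc0 S)
  have h2 : ‖∑ i ∈ Finset.range S, ((c i - c (i + 1) : ℝ) : ℂ) *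
      ∑ j ∈ Finset.range (i + 1), d j‖ ≤ ∑ i ∈ Finset.range S, (c i - c (i + 1)) * A := by
    refine (norm_sum_le _ _).trans (Finset.sum_le_sum fun i hi => ?_)
    have : 0 ≤ c i - c (i + 1) := sub_nonneg.2 (hc (Nat.le_succ i))
    rw [norm_mul, Complex.norm_real, Real.norm_of_nonneg this]
    exact mul_le_mul_of_nonneg_left (hA _ (Finset.mem_range.1 hi)) this
  rw [← Finset.sum_mul, Finset.sum_range_sub'] at h2
  linarith

end Kernels

/-! ### Vilenkin-Fourier analysis -/

section Fourier

variable {m : ℕ → ℕ} [∀ k, NeZero (m k)]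

theorem rademacher_eq (k : ℕ) (x : Group m) : rademacher m k x = ZMod.stdAddChar (x k) := by
  rw [ZMod.stdAddChar_apply, ZMod.toCircle_apply]; rfl

theorem norm_rademacher (k : ℕ) (x : Group m) : ‖rademacher m k x‖ = 1 := by
  rw [rademacher_eq, ZMod.stdAddChar_apply]; exact Circle.norm_coe _

theorem rademacher_pow (k : ℕ) (x : Group m) : rademacher m k x ^ m k = 1 := by
  rw [rademacher_eq, ← AddChar.map_nsmul_eq_pow, nsmul_eq_mul, CharP.cast_eq_zero, zero_mul,
    AddChar.map_zero_eq_one]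

/-- The roots of unity `r_k(x) conj (r_k(y)) = r_k(x - y)`. -/
def root (m : ℕ → ℕ) (x y : Group m) (k : ℕ) : ℂ := rademacher m k x * conj (rademacher m k y)

theorem root_pow (x y : Group m) (k : ℕ) : root m x y k ^ m k = 1 := by
  rw [root, mul_pow, ← map_pow, rademacher_pow, rademacher_pow, map_one, mul_one]

theorem stdAddChar_mul_conj_eq_one_iff {N : ℕ} [NeZero N] (a b : ZMod N) :
    ZMod.stdAddChar a * conj (ZMod.stdAddChar b) = 1 ↔ a = b := by
  have hb : ZMod.stdAddChar b * conj (ZMod.stdAddChar b) = 1 := by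
    rw [Complex.mul_conj, Complex.normSq_eq_norm_sq, ZMod.stdAddChar_apply, Circle.norm_coe]
    simp
  constructor
  · intro h
    have h0 : conj (ZMod.stdAddChar b) ≠ 0 := right_ne_zero_of_mul_eq_one hb
    exact ZMod.injective_stdAddChar (mul_right_cancel₀ h0 (h.trans hb.symm))
  · rintro rfl; exact hb

theorem root_eq_one_iff {x y : Group m} {k : ℕ} : root m x y k = 1 ↔ y k = x k := by
  rw [root, rademacher_eq, rademacher_eq, stdAddChar_mul_conj_eq_one_iff, eq_comm]

omit [∀ k, NeZero (m k)] in
theorem psi_eq_chi (n : ℕ) (x : Group m) : psi m n x = chi m (fun k => rademacher m k x) n := rfl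

theorem norm_psi (n : ℕ) (x : Group m) : ‖psi m n x‖ = 1 :=
  norm_chi (fun k => norm_rademacher k x) n

omit [∀ k, NeZero (m k)] in
theorem chi_root (x y : Group m) (n : ℕ) :
    chi m (root m x y) n = psi m n x * conj (psi m n y) := by
  simp only [chi, root, psi, mul_pow, Finset.prod_mul_distrib, map_prod, map_pow]

omit [∀ k, NeZero (m k)] in
theorem isLevel_psi (hm : ∀ k, 2 ≤ m k) {n N : ℕ} (h : n < M m N) : IsLevel N (psi m n) := by
  intro x y hy
  refine chi_congr hm h fun k hk => ?_
  simp [rademacher, hy k hk]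

theorem dirichlet_root (hm : ∀ k, 2 ≤ m k) (x y : Group m) (N : ℕ) :
    dirichlet m (root m x y) (M m N) =
      (interval m N x).indicator (fun _ => (M m N : ℂ)) y := by
  classical
  by_cases h : y ∈ interval m N x
  · rw [Set.indicator_of_mem h]
    exact dirichlet_M_of_eq_one hm fun k hk => root_eq_one_iff.2 (h k hk)
  · rw [Set.indicator_of_notMem h]
    simp only [mem_interval, not_forall] at h
    obtain ⟨k, hk, hne⟩ := h
    exact dirichlet_M_eq_zero hm (root_pow x y) hk fun h1 => hne (root_eq_one_iff.1 h1)

/-- The Vilenkin-Fourier coefficient of a function. -/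
def fourierCoeff (g : Group m → ℂ) (i : ℕ) : ℂ := ∫ x, g x * conj (psi m i x) ∂haar m

omit [∀ k, NeZero (m k)] in
theorem measurable_psi (hm : ∀ k, 2 ≤ m k) (i : ℕ) : Measurable (psi m i) := by
  have : ∀ k, NeZero (m k) := fun k => ⟨by have := hm k; omega⟩
  exact (isLevel_psi hm (lt_M hm i)).measurable

theorem integrable_mul_conj_psi (hm : ∀ k, 2 ≤ m k) {g : Group m → ℂ}
    (hg : Integrable g (haar m)) (i : ℕ) :
    Integrable (fun x => g x * conj (psi m i x)) (haar m) := by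
  refine hg.mul_bdd (c := 1)
    (Complex.continuous_conj.measurable.comp (measurable_psi hm i)).aestronglyMeasurable
    (Eventually.of_forall fun x => ?_)
  rw [RCLike.norm_conj, norm_psi]

/-- The partial sum over the indices below `M_N` is the average over intervals. -/
theorem sum_fourierCoeff_mul_psi (hm : ∀ k, 2 ≤ m k) {g : Group m → ℂ}
    (hg : Integrable g (haar m)) (N : ℕ) (x : Group m) :
    ∑ i ∈ Finset.range (M m N), fourierCoeff g i * psi m i x =
      M m N * ∫ t in interval m N x, g t ∂haar m := by
  have h1 : ∀ i, fourierCoeff g i * psi m i x =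
      ∫ t, g t * conj (psi m i t) * psi m i x ∂haar m := fun i => (integral_mul_const _ _).symm
  simp only [h1]
  rw [← integral_finsetSum _ fun i _ => (integrable_mul_conj_psi hm hg i).mul_const _,
    ← integral_indicator (measurableSet_interval m N x), ← integral_const_mul]
  refine integral_congr_ae (Eventually.of_forall fun t => ?_)
  have h2 : ∑ i ∈ Finset.range (M m N), g t * conj (psi m i t) * psi m i x =
      g t * dirichlet m (root m x t) (M m N) := by
    rw [dirichlet, Finset.mul_sum]
    refine Finset.sum_congr rfl fun i _ => ?_
    rw [chi_root]; ring
  simp only [h2, dirichlet_root hm]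
  classical
  simp only [Set.indicator_apply]
  split_ifs <;> ring

theorem IsLevel.eq_sum (hm : ∀ k, 2 ≤ m k) {N : ℕ} {g : Group m → ℂ} (hg : IsLevel N g)
    (x : Group m) : g x = ∑ i ∈ Finset.range (M m N), fourierCoeff g i * psi m i x := by
  have h0 : (M m N : ℂ) ≠ 0 := by exact_mod_cast (M_pos (m := m) N).ne'
  rw [sum_fourierCoeff_mul_psi hm hg.integrable, setIntegral_interval hg, mul_inv_cancel_left₀ h0]

omit [∀ k, NeZero (m k)] in
theorem chi_mul_left (hm : ∀ k, 2 ≤ m k) {ζ ξ : ℕ → ℂ} {d : ℕ} {c : ℂ}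
    (h : ∀ k, k ≠ d → ξ k = ζ k) (hd : ξ d = c * ζ d) (n : ℕ) :
    chi m ξ n = c ^ digit m n d * chi m ζ n := by
  have : ∀ k, NeZero (m k) := fun k => ⟨by have := hm k; omega⟩
  have hn : n < M m (n + d + 1) := (lt_M hm n).trans_le (M_mono (by omega))
  have hd' : d ∈ Finset.range (n + d + 1) := Finset.mem_range.2 (by omega)
  rw [chi_eq_of_lt_M hm hn, chi_eq_of_lt_M hm hn, ← Finset.mul_prod_erase _ _ hd',
    ← Finset.mul_prod_erase _ (fun k => ζ k ^ digit m n k) hd', hd, mul_pow, mul_assoc]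
  congr 2
  exact Finset.prod_congr rfl fun k hk => by rw [h k (Finset.ne_of_mem_erase hk)]

omit [∀ k, NeZero (m k)] in
theorem eq_of_digit_eq (hm : ∀ k, 2 ≤ m k) {i j : ℕ} (h : ∀ k, digit m i k = digit m j k) :
    i = j := by
  have : ∀ k, NeZero (m k) := fun k => ⟨by have := hm k; omega⟩
  have key : ∀ k, i % M m k = j % M m k := by
    intro k
    induction k with
    | zero => simp [M, Nat.mod_one]
    | succ k ih =>
      have hk := h k
      rw [digit, digit] at hk
      rw [M_succ, Nat.mod_mul, Nat.mod_mul, ih, hk]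
  have h1 := key (i + j)
  rwa [Nat.mod_eq_of_lt ((lt_M hm i).trans_le (M_mono (by omega))),
    Nat.mod_eq_of_lt ((lt_M hm j).trans_le (M_mono (by omega)))] at h1

theorem psi_add_single (hm : ∀ k, 2 ≤ m k) (n d : ℕ) (x : Group m) :
    psi m n (x + Pi.single d 1) =
      ZMod.stdAddChar (digit m n d : ZMod (m d)) * psi m n x := by
  have h := chi_mul_left hm (ζ := fun k => rademacher m k x)
    (ξ := fun k => rademacher m k (x + Pi.single d 1)) (d := d)
    (c := ZMod.stdAddChar (1 : ZMod (m d))) (fun k hk => ?_) ?_ n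
  · rw [psi_eq_chi, psi_eq_chi, h, ← AddChar.map_nsmul_eq_pow, nsmul_eq_mul, mul_one]
  · simp [rademacher, Pi.single_eq_of_ne hk]
  · rw [rademacher_eq, rademacher_eq, Pi.add_apply, Pi.single_eq_same, AddChar.map_add_eq_mul,
      mul_comm]

/-- Distinct indices differ in some digit `d`. Translating coordinate `d` by `1` preserves the
measure and multiplies the integrand by a constant `c ≠ 1`, so the integral vanishes. -/
theorem fourierCoeff_psi (hm : ∀ k, 2 ≤ m k) (i j : ℕ) :
    fourierCoeff (psi m i) j = if i = j then 1 else 0 := by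
  split_ifs with hij
  · subst hij
    have : ∀ x, psi m i x * conj (psi m i x) = 1 := fun x => by
      rw [Complex.mul_conj, Complex.normSq_eq_norm_sq, norm_psi]; simp
    simp [fourierCoeff, this]
  · have hd : ∃ d, digit m i d ≠ digit m j d := by
      by_contra! hcon
      exact hij (eq_of_digit_eq hm hcon)
    obtain ⟨d, hd⟩ := hd
    set c : ℂ := ZMod.stdAddChar (digit m i d : ZMod (m d)) *
      conj (ZMod.stdAddChar (digit m j d : ZMod (m d))) with hc
    have hc1 : c ≠ 1 := by
      rw [hc, Ne, stdAddChar_mul_conj_eq_one_iff, ZMod.natCast_eq_natCast_iff']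
      have hpos := NeZero.pos (m d)
      have hlt : ∀ n, digit m n d < m d := fun n => Nat.mod_lt _ hpos
      rwa [Nat.mod_eq_of_lt (hlt i), Nat.mod_eq_of_lt (hlt j)]
    have h1 : fourierCoeff (psi m i) j = c * fourierCoeff (psi m i) j := by
      conv_lhs => rw [fourierCoeff, ← (measurePreserving_add_right
        (Pi.single d 1 : Group m)).integral_comp (measurableEmbedding_add_right _)]
      rw [fourierCoeff, ← integral_const_mul]
      refine integral_congr_ae (Eventually.of_forall fun x => ?_)
      simp only [psi_add_single hm, map_mul, hc]
      ring
    have h2 : (c - 1) * fourierCoeff (psi m i) j = 0 := by rw [sub_mul, ← h1, one_mul, sub_self]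
    exact (mul_eq_zero.1 h2).resolve_left (sub_ne_zero.2 hc1)

theorem integrable_psi (hm : ∀ k, 2 ≤ m k) (i : ℕ) : Integrable (psi m i) (haar m) :=
  (isLevel_psi hm (lt_M hm i)).integrable

omit [∀ k, NeZero (m k)] in
theorem fourierCoeff_const_mul (c : ℂ) (g : Group m → ℂ) (i : ℕ) :
    fourierCoeff (fun x => c * g x) i = c * fourierCoeff g i := by
  rw [fourierCoeff, fourierCoeff, ← integral_const_mul]
  simp only [mul_assoc]

theorem fourierCoeff_sum (hm : ∀ k, 2 ≤ m k) {ι : Type*} {s : Finset ι} {g : ι → Group m → ℂ}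
    (hg : ∀ a ∈ s, Integrable (g a) (haar m)) (i : ℕ) :
    fourierCoeff (fun x => ∑ a ∈ s, g a x) i = ∑ a ∈ s, fourierCoeff (g a) i := by
  simp only [fourierCoeff, Finset.sum_mul]
  exact integral_finsetSum _ fun a ha => integrable_mul_conj_psi hm (hg a ha) i

theorem fourierCoeff_polynomial (hm : ∀ k, 2 ≤ m k) (b : ℕ → ℂ) (n j : ℕ) :
    fourierCoeff (fun x => ∑ i ∈ Finset.range n, b i * psi m i x) j = if j < n then b j else 0 := by
  rw [fourierCoeff_sum hm fun i _ => (integrable_psi hm i).const_mul _]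
  simp only [fourierCoeff_const_mul, fourierCoeff_psi hm, mul_ite, mul_one, mul_zero]
  simp

/-- Parseval's identity for polynomials. -/
theorem integral_norm_sq_polynomial (hm : ∀ k, 2 ≤ m k) (b : ℕ → ℂ) (n : ℕ) :
    ∫ x, ‖∑ i ∈ Finset.range n, b i * psi m i x‖ ^ 2 ∂haar m = ∑ i ∈ Finset.range n, ‖b i‖ ^ 2 := by
  have hint : Integrable (fun x => ∑ i ∈ Finset.range n, b i * psi m i x) (haar m) :=
    integrable_finsetSum _ fun i _ => (integrable_psi hm i).const_mul _
  have h : ((∫ x, ‖∑ i ∈ Finset.range n, b i * psi m i x‖ ^ 2 ∂haar m : ℝ) : ℂ) =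
      ((∑ i ∈ Finset.range n, ‖b i‖ ^ 2 : ℝ) : ℂ) := by
    rw [← integral_complex_ofReal]
    have h1 : ∀ x, ((‖∑ i ∈ Finset.range n, b i * psi m i x‖ ^ 2 : ℝ) : ℂ) =
        ∑ j ∈ Finset.range n, conj (b j) *
          ((∑ i ∈ Finset.range n, b i * psi m i x) * conj (psi m j x)) := by
      intro x
      rw [← Complex.normSq_eq_norm_sq, ← Complex.mul_conj]
      conv_lhs => rw [map_sum, Finset.mul_sum]
      refine Finset.sum_congr rfl fun j _ => ?_
      rw [map_mul]; ring
    simp only [h1]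
    rw [integral_finsetSum _ fun j _ => (integrable_mul_conj_psi hm hint j).const_mul _]
    push_cast
    refine Finset.sum_congr rfl fun j hj => ?_
    rw [integral_const_mul]
    have h2 := fourierCoeff_polynomial hm b n j
    rw [if_pos (Finset.mem_range.1 hj)] at h2
    rw [fourierCoeff] at h2
    rw [h2, mul_comm, Complex.mul_conj, Complex.normSq_eq_norm_sq]
    push_cast; rfl
  exact_mod_cast h

theorem IsLevel.sum_norm_sq_fourierCoeff (hm : ∀ k, 2 ≤ m k) {N : ℕ} {g : Group m → ℂ}
    (hg : IsLevel N g) :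
    ∑ i ∈ Finset.range (M m N), ‖fourierCoeff g i‖ ^ 2 = ∫ x, ‖g x‖ ^ 2 ∂haar m := by
  rw [← integral_norm_sq_polynomial hm]
  simp only [← hg.eq_sum hm]

/-- Conditional expectations, as everywhere defined averages. -/
theorem regular_apply {g : Group m → ℂ} (hg : Integrable g (haar m)) (n : ℕ) (x : Group m) :
    regular g n x = M m n * ∫ t in interval m n x, g t ∂haar m := by
  have h0 : (M m n : ℂ) ≠ 0 := by exact_mod_cast (M_pos (m := m) n).ne'
  -- The conditional expectation is measurable for the `n`-th σ-algebra itself, hence constant on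
  -- intervals, so no exceptional null set appears.
  have h1 : IsLevel n (regular g n) :=
    isLevel_of_stronglyMeasurable stronglyMeasurable_condExp
  have h2 : ∫ t in interval m n x, regular g n t ∂haar m = ∫ t in interval m n x, g t ∂haar m :=
    setIntegral_condExp ((filtration m).le n) hg
      (isLevel_mem_interval n x).measurableSet_filtration
  rw [← h2, setIntegral_interval h1, mul_inv_cancel_left₀ h0]

theorem regular_polynomial (hm : ∀ k, 2 ≤ m k) (b : ℕ → ℂ) (n k : ℕ) (x : Group m) :
    regular (fun x => ∑ i ∈ Finset.range n, b i * psi m i x) k x =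
      ∑ i ∈ Finset.range (min n (M m k)), b i * psi m i x := by
  have hint : Integrable (fun x => ∑ i ∈ Finset.range n, b i * psi m i x) (haar m) :=
    integrable_finsetSum _ fun i _ => (integrable_psi hm i).const_mul _
  rw [regular_apply hint, ← sum_fourierCoeff_mul_psi hm hint]
  simp only [fourierCoeff_polynomial hm, ite_mul, zero_mul]
  rw [← Finset.sum_filter]
  refine Finset.sum_congr ?_ fun _ _ => rfl
  ext i
  simp [and_comm]

/-! ### Martingales and their Fourier coefficients. -/

section Martingale

variable {f : ℕ → Group m → ℂ} (hf : Martingale f (filtration m) (haar m))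
include hf

omit [∀ k, NeZero (m k)] in
theorem isLevel_martingale (n : ℕ) : IsLevel n (f n) :=
  isLevel_of_stronglyMeasurable (hf.stronglyAdapted n)

theorem martingale_setIntegral_eq {n k j : ℕ} (hk : n ≤ k) (hj : n ≤ j) {S : Set (Group m)}
    (hS : IsLevel n fun x => x ∈ S) :
    ∫ x in S, f k x ∂haar m = ∫ x in S, f j x ∂haar m :=
  (hf.setIntegral_eq hk hS.measurableSet_filtration).symm.trans
    (hf.setIntegral_eq hj hS.measurableSet_filtration)

theorem martingale_apply {n k : ℕ} (h : n ≤ k) (x : Group m) :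
    f n x = M m n * ∫ t in interval m n x, f k t ∂haar m := by
  have h0 : (M m n : ℂ) ≠ 0 := by exact_mod_cast (M_pos (m := m) n).ne'
  rw [martingale_setIntegral_eq hf h le_rfl (isLevel_mem_interval n x),
    setIntegral_interval (isLevel_martingale hf n), mul_inv_cancel_left₀ h0]

theorem martingale_eq_sum (hm : ∀ k, 2 ≤ m k) {n k : ℕ} (h : n ≤ k) (x : Group m) :
    f n x = ∑ i ∈ Finset.range (M m n), fourierCoeff (f k) i * psi m i x := by
  rw [sum_fourierCoeff_mul_psi hm (isLevel_martingale hf k).integrable, ← martingale_apply hf h]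

/-- From time `N` on the integrals are constant, so below frequency `M_N` the martingale may be
replaced by the single function `f N`. -/
theorem coeff_eq (hm : ∀ k, 2 ≤ m k) {N i : ℕ} (hi : i < M m N) :
    coeff f i = fourierCoeff (f N) i := by
  have h : ∀ k, N ≤ k → fourierCoeff (f k) i = fourierCoeff (f N) i := by
    intro k hk
    have h1 : f N = fun x => ∑ i ∈ Finset.range (M m N), fourierCoeff (f k) i * psi m i x :=
      funext fun x => martingale_eq_sum hf hm hk x
    rw [h1, fourierCoeff_polynomial hm, if_pos hi]
  refine Tendsto.limUnder_eq ?_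
  refine tendsto_const_nhds.congr' ?_
  filter_upwards [eventually_ge_atTop N] with k hk
  exact (h k hk).symm

end Martingale

/-- The partial sums of the Vilenkin-Fourier series of a function. -/
def fourierSum (n : ℕ) (g : Group m → ℂ) (x : Group m) : ℂ :=
  ∑ i ∈ Finset.range n, fourierCoeff g i * psi m i x

/-- The unnormalized Riesz logarithmic mean `∑_{1 ≤ j < n} S_j g / j`. -/
def rieszSum (n : ℕ) (g : Group m → ℂ) (x : Group m) : ℂ :=
  ∑ j ∈ Finset.Ico 1 n, fourierSum j g x / (j : ℂ)

omit [∀ k, NeZero (m k)] in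
theorem isLevel_fourierSum (hm : ∀ k, 2 ≤ m k) {n N : ℕ} (h : n ≤ M m N) (g : Group m → ℂ) :
    IsLevel N (fourierSum n g) :=
  IsLevel.sum fun _ hi => (isLevel_psi hm ((Finset.mem_range.1 hi).trans_le h)).comp _

omit [∀ k, NeZero (m k)] in
theorem isLevel_rieszSum (hm : ∀ k, 2 ≤ m k) {n N : ℕ} (h : n ≤ M m N) (g : Group m → ℂ) :
    IsLevel N (rieszSum n g) :=
  IsLevel.sum fun j hj => (isLevel_fourierSum hm ((Finset.mem_Ico.1 hj).2.le.trans h) g).comp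
    fun z => z / (j : ℂ)

theorem rieszSum_sum (hm : ∀ k, 2 ≤ m k) {ι : Type*} {s : Finset ι} {g : ι → Group m → ℂ}
    (hg : ∀ a ∈ s, Integrable (g a) (haar m)) (n : ℕ) (x : Group m) :
    rieszSum n (fun x => ∑ a ∈ s, g a x) x = ∑ a ∈ s, rieszSum n (g a) x := by
  simp only [rieszSum, fourierSum, fourierCoeff_sum hm hg, Finset.sum_mul]
  rw [Finset.sum_comm]
  refine Finset.sum_congr rfl fun j _ => ?_
  rw [Finset.sum_comm, Finset.sum_div]

theorem rieszMean_eq (hm : ∀ k, 2 ≤ m k) {f : ℕ → Group m → ℂ}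
    (hf : Martingale f (filtration m) (haar m)) {n N : ℕ} (h : n ≤ M m N) (x : Group m) :
    rieszMean f n x = 1 / (l n : ℂ) * rieszSum n (f N) x := by
  rw [rieszMean, rieszSum]
  congr 1
  refine Finset.sum_congr rfl fun j hj => ?_
  rw [partialSum, fourierSum]
  congr 1
  refine Finset.sum_congr rfl fun _ hi => ?_
  rw [coeff_eq hf hm (N := N)]
  have := Finset.mem_range.1 hi
  have := (Finset.mem_Ico.1 hj).2
  omega

theorem integrable_fourierSum (hm : ∀ k, 2 ≤ m k) (n : ℕ) (g : Group m → ℂ) :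
    Integrable (fourierSum n g) (haar m) :=
  (isLevel_fourierSum hm (lt_M hm n).le g).integrable

theorem integrable_rieszSum (hm : ∀ k, 2 ≤ m k) (n : ℕ) (g : Group m → ℂ) :
    Integrable (rieszSum n g) (haar m) :=
  (isLevel_rieszSum hm (lt_M hm n).le g).integrable

/-- Averaging over the intervals of level `k` discards exactly the frequencies from `M_k` on. -/
theorem regular_rieszSum (hm : ∀ k, 2 ≤ m k) (n k : ℕ) (g : Group m → ℂ) (x : Group m) :
    regular (rieszSum n g) k x =
      ∑ j ∈ Finset.Ico 1 n, fourierSum (min j (M m k)) g x / (j : ℂ) := by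
  rw [regular_apply (integrable_rieszSum hm n g)]
  simp only [rieszSum]
  rw [integral_finsetSum _ fun j _ => ((integrable_fourierSum hm j g).div_const _).integrableOn,
    Finset.mul_sum]
  refine Finset.sum_congr rfl fun j _ => ?_
  rw [integral_div, ← mul_div_assoc, ← regular_apply (integrable_fourierSum hm j g)]
  congr 1
  exact regular_polynomial hm _ _ _ _

theorem l_nonneg (n : ℕ) : 0 ≤ l n := Finset.sum_nonneg fun _ _ => by positivity

/-- The pointwise bound for the conditional expectations of the Riesz means. -/
theorem norm_regular_rieszMean_le (hm : ∀ k, 2 ≤ m k) {f : ℕ → Group m → ℂ}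
    (hf : Martingale f (filtration m) (haar m)) {n N : ℕ} (h : n ≤ M m N) (k : ℕ) (x : Group m) :
    ‖regular (rieszMean f n) k x‖ ≤ (l n)⁻¹ *
      (‖rieszSum n (f N) x‖ +
        ∑ j ∈ (Finset.range n).filter (fun j => M m j ≤ n), ‖rieszSum (M m j) (f N) x‖) +
      if k ≤ N then ‖f k x‖ else 0 := by
  have h1 : regular (rieszMean f n) k x = 1 / (l n : ℂ) * regular (rieszSum n (f N)) k x := by
    have he : rieszMean f n = fun x => 1 / (l n : ℂ) * rieszSum n (f N) x :=
      funext fun x => rieszMean_eq hm hf h x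
    rw [he, regular_apply ((integrable_rieszSum hm n (f N)).const_mul _),
      regular_apply (integrable_rieszSum hm n (f N)), integral_const_mul]
    ring
  have hl := l_nonneg n
  have hpos : 0 ≤ if k ≤ N then ‖f k x‖ else 0 := by split_ifs <;> positivity
  rw [h1, norm_mul, norm_div, norm_one, Complex.norm_real, Real.norm_of_nonneg hl, one_div,
    regular_rieszSum hm]
  -- If `n ≤ M_k` the average changes nothing. Otherwise the sum is cut at `M_k`, and all later
  -- partial sums collapse to `f k`.
  rcases le_or_gt n (M m k) with hnk | hnk
  · have h2 : ∑ j ∈ Finset.Ico 1 n, fourierSum (min j (M m k)) (f N) x / (j : ℂ) =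
        rieszSum n (f N) x := by
      refine Finset.sum_congr rfl fun j hj => ?_
      rw [min_eq_left ((Finset.mem_Ico.1 hj).2.le.trans hnk)]
    rw [h2]
    have h3 : 0 ≤ ∑ j ∈ (Finset.range n).filter (fun j => M m j ≤ n),
        ‖rieszSum (M m j) (f N) x‖ := Finset.sum_nonneg fun _ _ => norm_nonneg _
    refine le_add_of_le_of_nonneg (mul_le_mul_of_nonneg_left ?_ (inv_nonneg.2 hl)) hpos
    linarith
  · have hkN : k ≤ N := by
      by_contra hcon
      have := M_mono (m := m) (not_le.1 hcon).le
      omega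
    rw [← Finset.sum_Ico_consecutive _ (M_pos (m := m) k) hnk.le]
    have h2 : ∑ j ∈ Finset.Ico 1 (M m k), fourierSum (min j (M m k)) (f N) x / (j : ℂ) =
        rieszSum (M m k) (f N) x := by
      refine Finset.sum_congr rfl fun j hj => ?_
      rw [min_eq_left (Finset.mem_Ico.1 hj).2.le]
    have h3 : ∑ j ∈ Finset.Ico (M m k) n, fourierSum (min j (M m k)) (f N) x / (j : ℂ) =
        f k x * ((∑ j ∈ Finset.Ico (M m k) n, 1 / (j : ℝ) : ℝ) : ℂ) := by
      rw [martingale_eq_sum hf hm hkN]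
      push_cast
      rw [Finset.mul_sum]
      refine Finset.sum_congr rfl fun j hj => ?_
      rw [min_eq_right (Finset.mem_Ico.1 hj).1, mul_one_div]
      rfl
    have h4 : ∑ j ∈ Finset.Ico (M m k) n, 1 / (j : ℝ) ≤ l n :=
      Finset.sum_le_sum_of_subset_of_nonneg (Finset.Ico_subset_Ico_left (M_pos k))
        fun _ _ _ => by positivity
    have h5 : 0 ≤ ∑ j ∈ Finset.Ico (M m k) n, 1 / (j : ℝ) :=
      Finset.sum_nonneg fun _ _ => by positivity
    have h6 : ‖rieszSum (M m k) (f N) x‖ ≤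
        ∑ j ∈ (Finset.range n).filter (fun j => M m j ≤ n), ‖rieszSum (M m j) (f N) x‖ := by
      refine Finset.single_le_sum (f := fun j => ‖rieszSum (M m j) (f N) x‖)
        (fun _ _ => norm_nonneg _) ?_
      -- `k < M_k < n`, so restricting `j` to `range n` loses no index with `M_j < n`.
      exact Finset.mem_filter.2 ⟨Finset.mem_range.2 ((lt_M hm k).trans hnk), hnk.le⟩
    have h7 : (l n)⁻¹ * (‖f k x‖ * l n) ≤ ‖f k x‖ := by
      rw [mul_comm, mul_assoc]
      exact mul_le_of_le_one_right (norm_nonneg _) mul_inv_le_one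
    rw [h2, h3, if_pos hkN]
    calc (l n)⁻¹ * ‖rieszSum (M m k) (f N) x +
          f k x * ((∑ j ∈ Finset.Ico (M m k) n, 1 / (j : ℝ) : ℝ) : ℂ)‖
        ≤ (l n)⁻¹ * (‖rieszSum (M m k) (f N) x‖ + ‖f k x‖ * l n) := by
          refine mul_le_mul_of_nonneg_left ((norm_add_le _ _).trans ?_) (inv_nonneg.2 hl)
          rw [norm_mul, Complex.norm_real, Real.norm_of_nonneg h5]
          gcongr
      _ = (l n)⁻¹ * ‖rieszSum (M m k) (f N) x‖ + (l n)⁻¹ * (‖f k x‖ * l n) := mul_add _ _ _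
      _ ≤ _ := by
          refine add_le_add (mul_le_mul_of_nonneg_left ?_ (inv_nonneg.2 hl)) h7
          have := norm_nonneg (rieszSum n (f N) x)
          linarith

end Fourier

/-! ### Elementary estimates of sums -/

/-- The powers grow at least geometrically with ratio `2^p`. The constant solves `c 2^{-p} + 1 = c`,
which is what the induction step needs. -/
theorem sum_rpow_lacunary_le {t : ℕ → ℝ} (ht0 : ∀ k, 0 < t k) (ht : ∀ k, 2 * t k ≤ t (k + 1))
    {p : ℝ} (hp : 0 < p) (R : ℕ) :
    ∑ k ∈ Finset.range (R + 1), t k ^ p ≤ (1 - 2 ^ (-p))⁻¹ * t R ^ p := by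
  have h2 : (2 : ℝ) ^ (-p) < 1 := Real.rpow_lt_one_of_one_lt_of_neg one_lt_two (neg_lt_zero.2 hp)
  have h3 : (0 : ℝ) < 2 ^ (-p) := by positivity
  set c : ℝ := (1 - 2 ^ (-p))⁻¹ with hc
  have hc0 : 0 < c := inv_pos.2 (by linarith)
  have hc1 : c * 2 ^ (-p) + 1 = c := by
    have : (1 - (2 : ℝ) ^ (-p)) * c = 1 := mul_inv_cancel₀ (by linarith)
    linarith
  induction R with
  | zero =>
    have h4 : (0 : ℝ) < t 0 ^ p := Real.rpow_pos_of_pos (ht0 0) p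
    simp only [zero_add, Finset.sum_range_one]
    nlinarith [mul_pos hc0 h3]
  | succ R ih =>
    rw [Finset.sum_range_succ]
    have h4 : t R ^ p ≤ 2 ^ (-p) * t (R + 1) ^ p := by
      calc t R ^ p = 2 ^ (-p) * (2 * t R) ^ p := by
            rw [Real.mul_rpow zero_le_two (ht0 R).le, ← mul_assoc, ← Real.rpow_add zero_lt_two]
            simp
        _ ≤ 2 ^ (-p) * t (R + 1) ^ p := by
            have := (ht0 R).le
            gcongr
            exact ht R
    calc _ ≤ c * t R ^ p + t (R + 1) ^ p := by gcongr
      _ ≤ c * (2 ^ (-p) * t (R + 1) ^ p) + t (R + 1) ^ p := by gcongr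
      _ = (c * 2 ^ (-p) + 1) * t (R + 1) ^ p := by ring
      _ = _ := by rw [hc1]

/-- Used both for the indices `M_j ≤ n` and for the stopping levels below the maximal function. -/
theorem sum_filter_rpow_lacunary_le {t : ℕ → ℝ} (ht0 : ∀ k, 0 < t k)
    (ht : ∀ k, 2 * t k ≤ t (k + 1)) {p : ℝ} (hp : 0 < p) {s : ℝ} (hs : 0 ≤ s) (R : ℕ) :
    ∑ k ∈ (Finset.range R).filter (fun k => t k ≤ s), t k ^ p ≤ (1 - 2 ^ (-p))⁻¹ * s ^ p := by
  have h2 : (2 : ℝ) ^ (-p) < 1 := Real.rpow_lt_one_of_one_lt_of_neg one_lt_two (neg_lt_zero.2 hp)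
  have hc0 : 0 < (1 - (2 : ℝ) ^ (-p))⁻¹ := inv_pos.2 (by linarith)
  induction R with
  | zero => simpa using mul_nonneg hc0.le (Real.rpow_nonneg hs p)
  | succ R ih =>
    by_cases h : t R ≤ s
    · calc _ ≤ ∑ k ∈ Finset.range (R + 1), t k ^ p :=
            Finset.sum_le_sum_of_subset_of_nonneg (Finset.filter_subset _ _)
              fun k _ _ => Real.rpow_nonneg (ht0 k).le p
        _ ≤ _ := sum_rpow_lacunary_le ht0 ht hp R
        _ ≤ _ := by
          have := (ht0 R).le
          gcongr
    · rw [Finset.range_add_one, Finset.filter_insert, if_neg h]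
      exact ih

/-- Logarithmic growth is traded for a small power: `1/b ≤ Q^η / b^{1+η}` for `1 ≤ b ≤ Q`. The term
`b = 0` is zero by the convention `1/0 = 0`. -/
theorem sum_one_div_le {η : ℝ} (hη : 0 < η) (Q : ℕ) :
    ∑ b ∈ Finset.range (Q + 1), 1 / (b : ℝ) ≤ (∑' b : ℕ, 1 / (b : ℝ) ^ (1 + η)) * (Q : ℝ) ^ η := by
  have hs : Summable fun b : ℕ => 1 / (b : ℝ) ^ (1 + η) :=
    Real.summable_one_div_nat_rpow.2 (by linarith)
  calc ∑ b ∈ Finset.range (Q + 1), 1 / (b : ℝ)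
      ≤ ∑ b ∈ Finset.range (Q + 1), 1 / (b : ℝ) ^ (1 + η) * (Q : ℝ) ^ η := by
        refine Finset.sum_le_sum fun b hb => ?_
        have hbQ : (b : ℝ) ≤ Q := by exact_mod_cast Nat.lt_succ_iff.1 (Finset.mem_range.1 hb)
        rcases Nat.eq_zero_or_pos b with rfl | hb0
        · simp only [Nat.cast_zero, div_zero]
          positivity
        · have hb0' : (0 : ℝ) < b := by exact_mod_cast hb0
          rw [Real.rpow_add hb0', Real.rpow_one, div_mul_eq_mul_div, one_mul,
            div_le_div_iff₀ hb0' (by positivity), one_mul]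
          have : (b : ℝ) ^ η ≤ (Q : ℝ) ^ η := by gcongr
          nlinarith
    _ = (∑ b ∈ Finset.range (Q + 1), 1 / (b : ℝ) ^ (1 + η)) * (Q : ℝ) ^ η :=
        (Finset.sum_mul _ _ _).symm
    _ ≤ _ := by
        gcongr
        exact hs.sum_le_tsum _ fun b _ => by positivity

/-- Makes the tails of `∑ n^{-1-δ}` telescope. With `u = 1/n ≤ 1`, `log (1+u) ≥ u/2` gives `(1+u)^δ
≥ 1 + δu/2`, and `2 + δu ≤ 2(1+δ)` gives the constant. -/
theorem rpow_neg_sub_rpow_neg_le {δ : ℝ} (hδ : 0 < δ) {n : ℕ} (hn : 1 ≤ n) :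
    (n : ℝ) ^ (-1 - δ) ≤
      (2 * (1 + δ) / δ) * ((n : ℝ) ^ (-δ) - ((n + 1 : ℕ) : ℝ) ^ (-δ)) := by
  have hn0 : (0 : ℝ) < n := by exact_mod_cast hn
  have hn1 : (1 : ℝ) ≤ n := by exact_mod_cast hn
  set u : ℝ := (n : ℝ)⁻¹ with hu
  have hu0 : 0 < u := inv_pos.2 hn0
  have hu1 : u ≤ 1 := inv_le_one_of_one_le₀ hn1
  have h1 : ((n + 1 : ℕ) : ℝ) ^ (-δ) = (n : ℝ) ^ (-δ) * (1 + u) ^ (-δ) := by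
    rw [← Real.mul_rpow hn0.le (by positivity)]
    congr 1
    rw [mul_add, mul_one, hu, mul_inv_cancel₀ hn0.ne']
    push_cast; ring
  have h2 : (n : ℝ) ^ (-1 - δ) = (n : ℝ) ^ (-δ) * u := by
    rw [show -1 - δ = -δ + -1 by ring, Real.rpow_add hn0, Real.rpow_neg_one]
  have h3 : (1 + u) ^ (-δ) ≤ 1 / (1 + δ * (u / 2)) := by
    rw [Real.rpow_neg (by positivity), ← one_div]
    refine one_div_le_one_div_of_le (by positivity) ?_
    have h4 : u / 2 ≤ Real.log (1 + u) := by
      have h5 := Real.one_sub_inv_le_log_of_pos (show 0 < 1 + u by positivity)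
      have h6 : u / 2 ≤ 1 - (1 + u)⁻¹ := by
        rw [← sub_nonneg]
        have : 1 - (1 + u)⁻¹ - u / 2 = u * (1 - u) / (2 * (1 + u)) := by field_simp; ring
        rw [this]
        exact div_nonneg (mul_nonneg hu0.le (by linarith)) (by positivity)
      linarith
    rw [Real.rpow_def_of_pos (by positivity)]
    have h7 := Real.add_one_le_exp (Real.log (1 + u) * δ)
    nlinarith
  have h8 : u ≤ (2 * (1 + δ) / δ) * (1 - (1 + u) ^ (-δ)) := by
    have h9 : u ≤ (2 * (1 + δ) / δ) * (1 - 1 / (1 + δ * (u / 2))) := by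
      rw [← sub_nonneg]
      have : (2 * (1 + δ) / δ) * (1 - 1 / (1 + δ * (u / 2))) - u =
          u * (2 * (1 + δ) - (2 + δ * u)) / (2 + δ * u) := by
        field_simp
        ring
      rw [this]
      exact div_nonneg (mul_nonneg hu0.le (by nlinarith)) (by positivity)
    refine h9.trans ?_
    gcongr
  rw [h1, h2]
  have h10 : 0 < (n : ℝ) ^ (-δ) := by positivity
  calc (n : ℝ) ^ (-δ) * u ≤ (n : ℝ) ^ (-δ) * ((2 * (1 + δ) / δ) * (1 - (1 + u) ^ (-δ))) := by gcongr
    _ = _ := by ring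

theorem sum_rpow_tail_le {δ : ℝ} (hδ : 0 < δ) {L : ℕ} (hL : 1 ≤ L) (R : ℕ) :
    ∑ n ∈ Finset.Ico L R, (n : ℝ) ^ (-1 - δ) ≤ (2 * (1 + δ) / δ) * (L : ℝ) ^ (-δ) := by
  rcases le_total R L with h | h
  · rw [Finset.Ico_eq_empty_of_le h, Finset.sum_empty]
    positivity
  calc ∑ n ∈ Finset.Ico L R, (n : ℝ) ^ (-1 - δ)
      ≤ ∑ n ∈ Finset.Ico L R,
          (2 * (1 + δ) / δ) * ((n : ℝ) ^ (-δ) - ((n + 1 : ℕ) : ℝ) ^ (-δ)) :=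
        Finset.sum_le_sum fun n hn =>
          rpow_neg_sub_rpow_neg_le hδ (hL.trans (Finset.mem_Ico.1 hn).1)
    _ = (2 * (1 + δ) / δ) * ((L : ℝ) ^ (-δ) - (R : ℝ) ^ (-δ)) := by
        rw [← Finset.mul_sum]
        congr 1
        have h1 := Finset.sum_Ico_sub (fun n : ℕ => -(n : ℝ) ^ (-δ)) h
        have h2 : ∀ n : ℕ, (n : ℝ) ^ (-δ) - ((n + 1 : ℕ) : ℝ) ^ (-δ) =
            -((n + 1 : ℕ) : ℝ) ^ (-δ) - -(n : ℝ) ^ (-δ) := fun n => by ring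
        simp only [h2, h1]
        ring
    _ ≤ _ := by
        have : (0 : ℝ) ≤ (R : ℝ) ^ (-δ) := by positivity
        gcongr
        linarith

/-- The growth of the Riesz sums of an atom supported on an interval of measure `1 / L`. -/
def growth (δ : ℝ) (L n : ℕ) : ℝ :=
  (n : ℝ) ^ δ + if L ≤ n then (L : ℝ) ^ δ * (n : ℝ) ^ δ else 0

theorem growth_nonneg (δ : ℝ) (L n : ℕ) : 0 ≤ growth δ L n := by
  unfold growth; split_ifs <;> positivity

theorem sum_growth_le {δ : ℝ} (hδ : 0 < δ) {m : ℕ → ℕ} (hm : ∀ k, 2 ≤ m k) (L n : ℕ) :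
    ∑ j ∈ (Finset.range n).filter (fun j => M m j ≤ n), growth δ L (M m j) ≤
      (1 - 2 ^ (-δ))⁻¹ * growth δ L n := by
  have : ∀ k, NeZero (m k) := fun k => ⟨by have := hm k; omega⟩
  have h1 : ∑ j ∈ (Finset.range n).filter (fun j => M m j ≤ n), (M m j : ℝ) ^ δ ≤
      (1 - 2 ^ (-δ))⁻¹ * (n : ℝ) ^ δ := by
    have h2 := sum_filter_rpow_lacunary_le (t := fun j => (M m j : ℝ))
      (fun k => by exact_mod_cast M_pos (m := m) k) (fun k => ?_) hδ (Nat.cast_nonneg n) n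
    · simpa only [Nat.cast_le] using h2
    · rw [M_succ]
      have : (2 : ℝ) ≤ m k := by exact_mod_cast hm k
      push_cast
      nlinarith [(Nat.cast_nonneg (M m k) : (0 : ℝ) ≤ M m k)]
  unfold growth
  rw [Finset.sum_add_distrib, mul_add]
  refine add_le_add h1 ?_
  split_ifs with hL
  · calc _ ≤ ∑ j ∈ (Finset.range n).filter (fun j => M m j ≤ n), (L : ℝ) ^ δ * (M m j : ℝ) ^ δ := by
          refine Finset.sum_le_sum fun j _ => ?_
          split_ifs
          · exact le_rfl
          · positivity
      _ = (L : ℝ) ^ δ * ∑ j ∈ (Finset.range n).filter (fun j => M m j ≤ n), (M m j : ℝ) ^ δ :=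
          (Finset.mul_sum _ _ _).symm
      _ ≤ (L : ℝ) ^ δ * ((1 - 2 ^ (-δ))⁻¹ * (n : ℝ) ^ δ) := by gcongr
      _ = _ := by ring
  · rw [mul_zero]
    refine (Finset.sum_eq_zero fun j hj => if_neg ?_).le
    have := (Finset.mem_filter.1 hj).2
    omega

/-- The large factor `L^δ` is present only for `n ≥ L`, where the tail of `∑ n^{-1-δ}` is of order
`L^{-δ}`; hence a bound independent of `L`. -/
theorem sum_weight_mul_growth_le {δ : ℝ} (hδ : 0 < δ) {L : ℕ} (hL : 1 ≤ L) (R : ℕ) :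
    ∑ n ∈ Finset.Ico 1 R, (n : ℝ) ^ (-1 - 2 * δ) * growth δ L n ≤ 2 * (2 * (1 + δ) / δ) := by
  have h1 : ∀ n ∈ Finset.Ico 1 R, (n : ℝ) ^ (-1 - 2 * δ) * growth δ L n =
      (n : ℝ) ^ (-1 - δ) + if L ≤ n then (L : ℝ) ^ δ * (n : ℝ) ^ (-1 - δ) else 0 := by
    intro n hn
    have hn0 : (0 : ℝ) < n := by exact_mod_cast (Finset.mem_Ico.1 hn).1
    have h2 : (n : ℝ) ^ (-1 - δ) = (n : ℝ) ^ (-1 - 2 * δ) * (n : ℝ) ^ δ := by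
      rw [← Real.rpow_add hn0]; congr 1; ring
    rw [h2, growth]
    split_ifs <;> ring
  rw [Finset.sum_congr rfl h1, Finset.sum_add_distrib, ← Finset.sum_filter, two_mul]
  refine add_le_add ?_ ?_
  · simpa using sum_rpow_tail_le hδ le_rfl R
  · have hL0 : (0 : ℝ) < L := by exact_mod_cast hL
    have h3 : (Finset.Ico 1 R).filter (fun n => L ≤ n) = Finset.Ico L R := by
      ext n; simp only [Finset.mem_filter, Finset.mem_Ico]; omega
    rw [h3, ← Finset.mul_sum]
    calc _ ≤ (L : ℝ) ^ δ * ((2 * (1 + δ) / δ) * (L : ℝ) ^ (-δ)) := by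
          gcongr
          exact sum_rpow_tail_le hδ hL R
      _ = (L : ℝ) ^ δ * (L : ℝ) ^ (-δ) * (2 * (1 + δ) / δ) := by ring
      _ = _ := by rw [← Real.rpow_add hL0, add_neg_cancel, Real.rpow_zero, one_mul]

/-! ### Atoms -/

section Atom

variable {m : ℕ → ℕ} [∀ k, NeZero (m k)]

/-- A function supported on the interval `I_N(y)`, bounded by `A` and of mean zero
unless the interval is the whole group. -/
structure IsAtom (N : ℕ) (y : Group m) (A : ℝ) (a : Group m → ℂ) : Prop where
  level : ∃ L, IsLevel L a
  supp : ∀ x, x ∉ interval m N y → a x = 0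
  bound : ∀ x, ‖a x‖ ≤ A
  mean : N = 0 ∨ ∫ x, a x ∂haar m = 0

variable {N : ℕ} {y : Group m} {A : ℝ} {a : Group m → ℂ}

omit [∀ k, NeZero (m k)] in
theorem IsAtom.nonneg (ha : IsAtom N y A a) : 0 ≤ A := (norm_nonneg _).trans (ha.bound y)

theorem IsAtom.integrable (ha : IsAtom N y A a) : Integrable a (haar m) := by
  obtain ⟨L, hL⟩ := ha.level
  exact hL.integrable

theorem IsAtom.norm_fourierCoeff_le (ha : IsAtom N y A a) (i : ℕ) :
    ‖fourierCoeff a i‖ ≤ A / M m N := by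
  rw [fourierCoeff, ← setIntegral_eq_integral_of_forall_compl_eq_zero (s := interval m N y)
    fun x hx => by rw [ha.supp x hx, zero_mul]]
  refine (norm_setIntegral_le_of_norm_le_const (C := A) (measure_lt_top _ _) fun x _ => ?_).trans ?_
  · rw [norm_mul, RCLike.norm_conj, norm_psi, mul_one]
    exact ha.bound x
  · rw [haar_real_interval, div_eq_mul_inv]

omit [∀ k, NeZero (m k)] in
-- For `s < M_N` the function `psi m s` is constant on the support of the atom.
theorem IsAtom.fourierCoeff_mul_add (hm : ∀ k, 2 ≤ m k) (ha : IsAtom N y A a) {s : ℕ}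
    (hs : s < M m N) (q : ℕ) :
    fourierCoeff a (q * M m N + s) = conj (psi m s y) * fourierCoeff a (q * M m N) := by
  rw [fourierCoeff, fourierCoeff, ← integral_const_mul]
  refine integral_congr_ae (Eventually.of_forall fun x => ?_)
  by_cases hx : x ∈ interval m N y
  · simp only [psi_eq_chi, chi_mul_add hm hs, map_mul]
    simp only [← psi_eq_chi]
    rw [isLevel_psi hm hs y x hx]
    ring
  · simp [ha.supp x hx]

/-- Each complete block of frequencies contributes the factor `D_{M_N}(x - y)`, zero off the
interval; only the incomplete last block remains. -/
theorem IsAtom.fourierSum_of_notMem (hm : ∀ k, 2 ≤ m k) (ha : IsAtom N y A a) {x : Group m}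
    (hx : x ∉ interval m N y) {s : ℕ} (hs : s ≤ M m N) (q : ℕ) :
    fourierSum (q * M m N + s) a x = fourierCoeff a (q * M m N) * psi m (q * M m N) x *
      dirichlet m (root m x y) s := by
  have h1 : ∀ b, ∀ t ≤ M m N, ∑ j ∈ Finset.range t,
      fourierCoeff a (b * M m N + j) * psi m (b * M m N + j) x =
      fourierCoeff a (b * M m N) * psi m (b * M m N) x * dirichlet m (root m x y) t := by
    intro b t ht
    rw [dirichlet, Finset.mul_sum]
    refine Finset.sum_congr rfl fun j hj => ?_
    have hj' : j < M m N := (Finset.mem_range.1 hj).trans_le ht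
    rw [ha.fourierCoeff_mul_add hm hj', chi_root]
    simp only [psi_eq_chi, chi_mul_add hm hj']
    ring
  have h2 : dirichlet m (root m x y) (M m N) = 0 := by
    rw [dirichlet_root hm, Set.indicator_of_notMem fun h => hx (mem_interval_comm.1 h)]
  rw [fourierSum, sum_range_mul_add, Finset.sum_eq_zero fun b _ => ?_, zero_add, h1 q s hs]
  rw [h1 b _ le_rfl, h2, mul_zero]

/-- Within block `b` the weights `1/(b M_N + j)` decrease, so Abel summation bounds the block by the
coefficient size `A / M_N` times the largest weight `1/(b M_N)` times `K`. -/
theorem IsAtom.norm_rieszSum_le_of_notMem (hm : ∀ k, 2 ≤ m k) (ha : IsAtom N y A a) {x : Group m}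
    (hx : x ∉ interval m N y) {K : ℝ} (hK : ∀ S ≤ M m N, ‖fejer m (root m x y) S‖ ≤ K) (n : ℕ) :
    ‖rieszSum n a x‖ ≤
      A / (M m N : ℝ) ^ 2 * (∑ b ∈ Finset.range (n / M m N + 1), 1 / (b : ℝ)) * K := by
  have hM : (0 : ℝ) < M m N := by exact_mod_cast M_pos (m := m) N
  have hK0 : 0 ≤ K := (norm_nonneg _).trans (hK 0 (Nat.zero_le _))
  have hA := ha.nonneg
  have hN : N ≠ 0 := by
    rintro rfl
    exact hx (by rw [interval_zero]; trivial)
  have hblock : ∀ b, ∀ t ≤ M m N, ‖∑ j ∈ Finset.range t,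
      fourierSum (b * M m N + j) a x / ((b * M m N + j : ℕ) : ℂ)‖ ≤
      A / (M m N : ℝ) ^ 2 * (1 / (b : ℝ)) * K := by
    intro b t ht
    -- The block `b = 0` vanishes because the atom has mean zero, in agreement with `1/0 = 0` in the
    -- bound.
    rcases Nat.eq_zero_or_pos b with rfl | hb
    · have h0 : fourierCoeff a 0 = 0 := by
        simpa [fourierCoeff, psi] using ha.mean.resolve_left hN
      rw [Finset.sum_eq_zero, norm_zero]
      · simp
      · intro j hj
        rw [ha.fourierSum_of_notMem hm hx ((Finset.mem_range.1 hj).le.trans ht), zero_mul, h0,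
          zero_mul, zero_mul, zero_div]
    · have hb' : (0 : ℝ) < b := by exact_mod_cast hb
      have h1 : ∑ j ∈ Finset.range t,
          fourierSum (b * M m N + j) a x / ((b * M m N + j : ℕ) : ℂ) =
          fourierCoeff a (b * M m N) * psi m (b * M m N) x *
            ∑ j ∈ Finset.range t, dirichlet m (root m x y) j *
              ((1 / ((b * M m N + j : ℕ) : ℝ) : ℝ) : ℂ) := by
        rw [Finset.mul_sum]
        refine Finset.sum_congr rfl fun j hj => ?_
        rw [ha.fourierSum_of_notMem hm hx ((Finset.mem_range.1 hj).le.trans ht)]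
        push_cast
        ring
      have h2 : ‖∑ j ∈ Finset.range t, dirichlet m (root m x y) j *
          ((1 / ((b * M m N + j : ℕ) : ℝ) : ℝ) : ℂ)‖ ≤ 1 / ((b * M m N + 0 : ℕ) : ℝ) * K := by
        refine norm_sum_mul_le_of_antitone (c := fun j => 1 / ((b * M m N + j : ℕ) : ℝ))
          (fun i j hij => ?_) (fun j => by positivity) t fun S hS => hK S (hS.trans ht)
        have : 0 < b * M m N := Nat.mul_pos hb (M_pos N)
        exact one_div_le_one_div_of_le (by exact_mod_cast (by omega : 0 < b * M m N + i))
          (by exact_mod_cast Nat.add_le_add_left hij _)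
      rw [h1, norm_mul, norm_mul, norm_psi, mul_one]
      calc _ ≤ A / M m N * (1 / ((b * M m N + 0 : ℕ) : ℝ) * K) := by
            gcongr
            exact ha.norm_fourierCoeff_le _
        _ = _ := by rw [add_zero]; push_cast; field_simp
  -- The term `j = 0` is zero; adjoining it aligns the sum with the blocks.
  have hrange : rieszSum n a x = ∑ j ∈ Finset.range n, fourierSum j a x / (j : ℂ) := by
    rw [rieszSum, Finset.range_eq_Ico]
    refine Finset.sum_subset (Finset.Ico_subset_Ico_left (Nat.zero_le 1)) fun j hj hj' => ?_
    have : j = 0 := by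
      simp only [Finset.mem_Ico, not_and, not_lt] at hj hj'
      omega
    simp [this]
  rw [hrange]
  conv_lhs => rw [← Nat.div_add_mod' n (M m N)]
  rw [sum_range_mul_add (fun j => fourierSum j a x / (j : ℂ)), Finset.sum_range_succ, mul_add,
    add_mul]
  refine (norm_add_le _ _).trans (add_le_add ?_ (hblock _ _ (Nat.mod_lt n (M_pos N)).le))
  rw [Finset.mul_sum, Finset.sum_mul]
  exact (norm_sum_le _ _).trans (Finset.sum_le_sum fun b _ => hblock b _ le_rfl)

omit [∀ k, NeZero (m k)] in
theorem rieszSum_eq_polynomial (n : ℕ) (g : Group m → ℂ) (x : Group m) :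
    rieszSum n g x = ∑ i ∈ Finset.range n,
      ((∑ j ∈ (Finset.Ico 1 n).filter (fun j => i < j), 1 / (j : ℝ) : ℝ) : ℂ) *
        fourierCoeff g i * psi m i x := by
  have h1 : rieszSum n g x = ∑ j ∈ Finset.Ico 1 n, ∑ i ∈ Finset.range j,
      fourierCoeff g i * psi m i x / (j : ℂ) :=
    Finset.sum_congr rfl fun j _ => Finset.sum_div _ _ _
  rw [h1, Finset.sum_comm' (t' := Finset.range n)
    (s' := fun i => (Finset.Ico 1 n).filter fun j => i < j)]
  · refine Finset.sum_congr rfl fun i _ => ?_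
    push_cast
    rw [Finset.sum_mul, Finset.sum_mul]
    exact Finset.sum_congr rfl fun j _ => by ring
  · intro j i
    simp only [Finset.mem_Ico, Finset.mem_range, Finset.mem_filter]
    omega

/-- The Riesz sum is a Fourier multiplier with values in `[0, l n]`, so Parseval applies. -/
theorem IsLevel.integral_norm_sq_rieszSum_le (hm : ∀ k, 2 ≤ m k) {L : ℕ} {g : Group m → ℂ}
    (hg : IsLevel L g) (n : ℕ) :
    ∫ x, ‖rieszSum n g x‖ ^ 2 ∂haar m ≤ l n ^ 2 * ∫ x, ‖g x‖ ^ 2 ∂haar m := by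
  have hn : n ≤ M m (max L n) := (lt_M hm n).le.trans (M_mono (le_max_right _ _))
  rw [← (hg.mono (le_max_left L n)).sum_norm_sq_fourierCoeff hm]
  simp only [rieszSum_eq_polynomial n g]
  rw [integral_norm_sq_polynomial hm, Finset.mul_sum]
  refine (Finset.sum_le_sum (g := fun i => l n ^ 2 * ‖fourierCoeff g i‖ ^ 2) fun i _ => ?_).trans
    (Finset.sum_le_sum_of_subset_of_nonneg (Finset.range_mono hn) fun _ _ _ => by positivity)
  have h0 : 0 ≤ ∑ j ∈ (Finset.Ico 1 n).filter (fun j => i < j), 1 / (j : ℝ) :=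
    Finset.sum_nonneg fun _ _ => by positivity
  have h1 : ∑ j ∈ (Finset.Ico 1 n).filter (fun j => i < j), 1 / (j : ℝ) ≤ l n :=
    Finset.sum_le_sum_of_subset_of_nonneg (Finset.filter_subset _ _) fun _ _ _ => by positivity
  rw [norm_mul, Complex.norm_real, Real.norm_of_nonneg h0, mul_pow]
  gcongr

theorem IsAtom.integral_norm_sq_le (ha : IsAtom N y A a) :
    ∫ x, ‖a x‖ ^ 2 ∂haar m ≤ A ^ 2 * (M m N : ℝ)⁻¹ := by
  rw [← setIntegral_eq_integral_of_forall_compl_eq_zero (s := interval m N y)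
    fun x hx => by rw [ha.supp x hx]; simp, ← haar_real_interval N y]
  refine (Real.le_norm_self _).trans
    (norm_setIntegral_le_of_norm_le_const (measure_lt_top _ _) fun x _ => ?_)
  rw [norm_pow, norm_norm]
  gcongr
  exact ha.bound x

/-- Plays the role of Hölder's inequality in passing from `L²` to `L^p` on the interval. With `r = A
* h` both terms integrate to at most `(A h)^p / M_N`. -/
theorem rpow_le_rpow_add {u r p : ℝ} (hu : 0 ≤ u) (hr : 0 < r) (hp0 : 0 < p) (hp : p < 2) :
    u ^ p ≤ r ^ p + r ^ (p - 2) * u ^ 2 := by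
  rcases le_total u r with h | h
  · have : u ^ p ≤ r ^ p := by gcongr
    have : 0 ≤ r ^ (p - 2) * u ^ 2 := by positivity
    linarith
  · have hu' := hr.trans_le h
    have h1 : u ^ p = u ^ (p - 2) * u ^ 2 := by
      rw [← Real.rpow_natCast u 2, ← Real.rpow_add hu']
      congr 1; push_cast; ring
    have h2 : u ^ (p - 2) ≤ r ^ (p - 2) := Real.rpow_le_rpow_of_nonpos hr h (by linarith)
    have h3 : u ^ (p - 2) * u ^ 2 ≤ r ^ (p - 2) * u ^ 2 := by gcongr
    have : 0 ≤ r ^ p := by positivity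
    linarith

theorem IsAtom.setLIntegral_interval_le (hm : ∀ k, 2 ≤ m k) (ha : IsAtom N y A a) (hA : 0 < A)
    {p : ℝ} (hp0 : 0 < p) (hp : p < 2) {n : ℕ} {h : ℝ} (hh : 0 < h) (hl : l n ≤ h) :
    ∫⁻ x in interval m N y, ‖rieszSum n a x‖ₑ ^ p ∂haar m ≤
      ENNReal.ofReal (2 * (A * h) ^ p * (M m N : ℝ)⁻¹) := by
  obtain ⟨L, hL⟩ := ha.level
  have hlev := isLevel_rieszSum hm (lt_M hm n).le a
  have hint : Integrable (fun x => ‖rieszSum n a x‖ ^ 2) (haar m) :=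
    (hlev.comp fun z => ‖z‖ ^ 2).integrable
  have hr : 0 < A * h := by positivity
  have h1 : ∀ x, ‖rieszSum n a x‖ₑ ^ p ≤
      ENNReal.ofReal ((A * h) ^ p + (A * h) ^ (p - 2) * ‖rieszSum n a x‖ ^ 2) := by
    intro x
    rw [← ofReal_norm, ENNReal.ofReal_rpow_of_nonneg (norm_nonneg _) hp0.le]
    exact ENNReal.ofReal_le_ofReal (rpow_le_rpow_add (norm_nonneg _) hr hp0 hp)
  refine (lintegral_mono h1).trans ?_
  rw [← ofReal_integral_eq_lintegral_ofReal]
  · refine ENNReal.ofReal_le_ofReal ?_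
    rw [integral_add (integrable_const _) (hint.integrableOn.const_mul _), setIntegral_const,
      integral_const_mul, haar_real_interval, smul_eq_mul]
    have h2 : ∫ x in interval m N y, ‖rieszSum n a x‖ ^ 2 ∂haar m ≤
        h ^ 2 * (A ^ 2 * (M m N : ℝ)⁻¹) := by
      refine (setIntegral_le_integral hint (Eventually.of_forall fun x => by positivity)).trans ?_
      refine (hL.integral_norm_sq_rieszSum_le hm n).trans ?_
      have := l_nonneg n
      gcongr
      exact ha.integral_norm_sq_le
    have h3 : (A * h) ^ (p - 2) * (h ^ 2 * (A ^ 2 * (M m N : ℝ)⁻¹)) =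
        (A * h) ^ p * (M m N : ℝ)⁻¹ := by
      have : (A * h) ^ p = (A * h) ^ (p - 2) * (A * h) ^ 2 := by
        rw [← Real.rpow_natCast (A * h) 2, ← Real.rpow_add hr]
        congr 1; push_cast; ring
      rw [this]; ring
    calc _ ≤ (M m N : ℝ)⁻¹ * (A * h) ^ p +
          (A * h) ^ (p - 2) * (h ^ 2 * (A ^ 2 * (M m N : ℝ)⁻¹)) := by gcongr
      _ = _ := by rw [h3]; ring
  · exact (integrable_const _).add (hint.integrableOn.const_mul _)
  · exact Eventually.of_forall fun x => by positivity

/-- Only coordinate `k` is free below `l`, so `m_k` intervals of level `l` cover the set. -/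
theorem haar_le_of_agree_off (y : Group m) {k l : ℕ} :
    haar m {x | ∀ i < l, i ≠ k → x i = y i} ≤ ENNReal.ofReal (m k / M m l) := by
  have h1 : {x | ∀ i < l, i ≠ k → x i = y i} ⊆
      ⋃ z ∈ (Finset.univ : Finset (ZMod (m k))), interval m l (Function.update y k z) := by
    intro x hx
    simp only [Finset.mem_univ, Set.iUnion_true, Set.mem_iUnion]
    refine ⟨x k, fun i hi => ?_⟩
    rcases eq_or_ne i k with rfl | hik
    · simp
    · rw [Function.update_of_ne hik]
      exact hx i hi hik
  refine (measure_mono h1).trans ((measure_biUnion_finset_le _ _).trans ?_)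
  simp only [haar_interval, Finset.sum_const, Finset.card_univ, ZMod.card, nsmul_eq_mul]
  have hM : (0 : ℝ) < M m l := by exact_mod_cast M_pos (m := m) l
  rw [ENNReal.ofReal_div_of_pos hM, ENNReal.ofReal_natCast, ENNReal.ofReal_natCast, div_eq_mul_inv]

theorem measurableSet_agree_off (y : Group m) (k l : ℕ) :
    MeasurableSet {x : Group m | ∀ i < l, i ≠ k → x i = y i} := by
  refine IsLevel.measurableSet (n := l) fun a b hab => ?_
  simp only [Set.mem_ofPred_eq, eq_iff_iff]
  exact forall_congr' fun i => forall_congr' fun hi => by rw [hab i hi]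

/-- Points off the interval are sorted by the pair `k < l` of the kernel bound. The factor `i` in
the series counts the choices of `k < l = i`, and the ratio `2^{2p-1}` is below `1` because `p <
1/2`. -/
theorem IsAtom.setLIntegral_compl_le {B : ℕ} (hm : ∀ k, 2 ≤ m k) (hB : ∀ k, m k ≤ B)
    (ha : IsAtom N y A a) {p : ℝ} (hp0 : 0 < p) (hp : p < 1 / 2) (n : ℕ) {G : ℝ}
    (hG : A / (M m N : ℝ) ^ 2 * (∑ b ∈ Finset.range (n / M m N + 1), 1 / (b : ℝ)) ≤ G) :
    ∫⁻ x in (interval m N y)ᶜ, ‖rieszSum n a x‖ₑ ^ p ∂haar m ≤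
      ENNReal.ofReal ((2 * B ^ 2 * G) ^ p * B *
        ∑' i : ℕ, (i : ℝ) * ((2 : ℝ) ^ (2 * p - 1)) ^ i) := by
  have hA := ha.nonneg
  have hG0 : 0 ≤ G := le_trans (mul_nonneg (by positivity)
    (Finset.sum_nonneg fun _ _ => by positivity)) hG
  set ρ : ℝ := (2 : ℝ) ^ (2 * p - 1) with hρ
  have hρ0 : 0 < ρ := by positivity
  have hρ1 : ρ < 1 := Real.rpow_lt_one_of_one_lt_of_neg one_lt_two (by linarith)
  let c : ℕ → ℕ → ℝ := fun k l => (G * (2 * M m (k + 1) * M m (l + 1))) ^ p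
  let E : ℕ → ℕ → Set (Group m) := fun k l => {x | ∀ i < l, i ≠ k → x i = y i}
  have hpt : ∀ x ∈ (interval m N y)ᶜ, ‖rieszSum n a x‖ₑ ^ p ≤
      ∑ l ∈ Finset.range (N + 1), ∑ k ∈ Finset.range l,
        (E k l).indicator (fun _ => ENNReal.ofReal (c k l)) x := by
    intro x hx
    have hex : ∃ k < N, root m x y k ≠ 1 := by
      by_contra! hcon
      exact hx fun k hk => (root_eq_one_iff.1 (hcon k hk)).symm
    obtain ⟨k, l, hkl, hlN, hagree, hK⟩ := exists_norm_fejer_le hm (root_pow x y) hex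
    have hxE : x ∈ E k l := fun i hi hik => (root_eq_one_iff.1 (hagree i hi hik)).symm
    have h1 : ‖rieszSum n a x‖ ≤ G * (2 * M m (k + 1) * M m (l + 1)) :=
      (ha.norm_rieszSum_le_of_notMem hm hx hK n).trans (by gcongr)
    have h2 : ‖rieszSum n a x‖ₑ ^ p ≤ (E k l).indicator (fun _ => ENNReal.ofReal (c k l)) x := by
      rw [Set.indicator_of_mem hxE, ← ofReal_norm,
        ENNReal.ofReal_rpow_of_nonneg (norm_nonneg _) hp0.le]
      refine ENNReal.ofReal_le_ofReal ?_
      show _ ≤ (G * (2 * M m (k + 1) * M m (l + 1))) ^ p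
      gcongr
    refine h2.trans ?_
    refine le_trans ?_ (Finset.single_le_sum (f := fun l => ∑ k ∈ Finset.range l,
        (E k l).indicator (fun _ => ENNReal.ofReal (c k l)) x) (fun _ _ => zero_le)
        (Finset.mem_range.2 (Nat.lt_succ_of_le hlN)))
    exact Finset.single_le_sum (f := fun k => (E k l).indicator
      (fun _ => ENNReal.ofReal (c k l)) x) (fun _ _ => zero_le) (Finset.mem_range.2 hkl)
  -- `M_{k+1} M_{l+1} ≤ B² M_l²`; the `p`-th power divided by `M_l` leaves `M_l^{2p-1} ≤
  -- (2^l)^{2p-1}`.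
  have hterm : ∀ k l, k < l → c k l * (m k / M m l) ≤ (2 * B ^ 2 * G) ^ p * B * ρ ^ l := by
    intro k l hkl
    have hMl : (0 : ℝ) < M m l := by exact_mod_cast M_pos (m := m) l
    have hmk : (m k : ℝ) ≤ B := by exact_mod_cast hB k
    have hB0 : (0 : ℝ) ≤ B := Nat.cast_nonneg B
    have hsucc : ∀ j, (M m (j + 1) : ℝ) ≤ B * M m j := by
      intro j
      rw [M_succ, mul_comm]
      push_cast
      gcongr
      exact_mod_cast hB j
    have hMkl : (M m k : ℝ) ≤ M m l := by exact_mod_cast M_mono hkl.le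
    have h1 : G * (2 * M m (k + 1) * M m (l + 1)) ≤ (2 * B ^ 2 * G) * (M m l) ^ 2 := by
      calc _ ≤ G * (2 * (B * M m l) * (B * M m l)) := by
            gcongr
            · exact (hsucc k).trans (by gcongr)
            · exact hsucc l
        _ = _ := by ring
    have h2 : c k l ≤ (2 * B ^ 2 * G) ^ p * (M m l : ℝ) ^ (2 * p) := by
      refine (Real.rpow_le_rpow (by positivity) h1 hp0.le).trans ?_
      rw [Real.mul_rpow (by positivity) (by positivity), ← Real.rpow_natCast (M m l : ℝ) 2,
        ← Real.rpow_mul hMl.le]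
      push_cast
      exact le_rfl
    have h3 : (M m l : ℝ) ^ (2 * p) / M m l ≤ ρ ^ l := by
      rw [← Real.rpow_sub_one hMl.ne', hρ, Real.rpow_pow_comm zero_le_two]
      exact Real.rpow_le_rpow_of_nonpos (by positivity)
        (by exact_mod_cast two_pow_le_M hm l) (by linarith)
    calc c k l * (m k / M m l)
        ≤ (2 * B ^ 2 * G) ^ p * (M m l : ℝ) ^ (2 * p) * (B / M m l) := by gcongr
      _ = (2 * B ^ 2 * G) ^ p * B * ((M m l : ℝ) ^ (2 * p) / M m l) := by ring
      _ ≤ _ := by gcongr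
  calc ∫⁻ x in (interval m N y)ᶜ, ‖rieszSum n a x‖ₑ ^ p ∂haar m
      ≤ ∫⁻ x in (interval m N y)ᶜ, ∑ l ∈ Finset.range (N + 1), ∑ k ∈ Finset.range l,
        (E k l).indicator (fun _ => ENNReal.ofReal (c k l)) x ∂haar m :=
        setLIntegral_mono' (measurableSet_interval m N y).compl hpt
    _ ≤ ∫⁻ x, ∑ l ∈ Finset.range (N + 1), ∑ k ∈ Finset.range l,
        (E k l).indicator (fun _ => ENNReal.ofReal (c k l)) x ∂haar m := setLIntegral_le_lintegral _ _
    _ = ∑ l ∈ Finset.range (N + 1), ∑ k ∈ Finset.range l,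
        ENNReal.ofReal (c k l) * haar m (E k l) := by
        have hmeas : ∀ k l, Measurable
            ((E k l).indicator fun _ => ENNReal.ofReal (c k l)) := fun k l =>
          measurable_const.indicator (measurableSet_agree_off y k l)
        rw [lintegral_finsetSum _ fun l _ => Finset.measurable_sum _ fun k _ => hmeas k l]
        refine Finset.sum_congr rfl fun l _ => ?_
        rw [lintegral_finsetSum _ fun k _ => hmeas k l]
        refine Finset.sum_congr rfl fun k _ => ?_
        rw [lintegral_indicator_const (measurableSet_agree_off y k l)]
    _ ≤ ∑ l ∈ Finset.range (N + 1), ∑ k ∈ Finset.range l,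
        ENNReal.ofReal ((2 * B ^ 2 * G) ^ p * B * ρ ^ l) := by
        refine Finset.sum_le_sum fun l _ => Finset.sum_le_sum fun k hk => ?_
        have hc0 : 0 ≤ c k l := by positivity
        refine (mul_le_mul_right (haar_le_of_agree_off y) _).trans ?_
        rw [← ENNReal.ofReal_mul hc0]
        exact ENNReal.ofReal_le_ofReal (hterm k l (Finset.mem_range.1 hk))
    _ = ENNReal.ofReal (∑ l ∈ Finset.range (N + 1), ∑ k ∈ Finset.range l,
        (2 * B ^ 2 * G) ^ p * B * ρ ^ l) := by
        rw [ENNReal.ofReal_sum_of_nonneg fun l _ => Finset.sum_nonneg fun k _ => by positivity]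
        refine Finset.sum_congr rfl fun l _ => ?_
        rw [ENNReal.ofReal_sum_of_nonneg fun k _ => by positivity]
    _ ≤ _ := by
        refine ENNReal.ofReal_le_ofReal ?_
        have hsum : Summable fun i : ℕ => (i : ℝ) * ρ ^ i := by
          have := summable_pow_mul_geometric_of_norm_lt_one 1
            (show ‖ρ‖ < 1 by rwa [Real.norm_of_nonneg hρ0.le])
          simpa using this
        calc _ = (2 * B ^ 2 * G) ^ p * B * ∑ i ∈ Finset.range (N + 1), (i : ℝ) * ρ ^ i := by
              rw [Finset.mul_sum]
              refine Finset.sum_congr rfl fun i _ => ?_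
              rw [Finset.sum_const, Finset.card_range, nsmul_eq_mul]; ring
          _ ≤ _ := by
              gcongr
              exact hsum.sum_le_tsum _ fun i _ => by positivity

end Atom

/-! ### Integral bounds and weighted sums for atoms. -/

section AtomBound

theorem l_le_sum (n : ℕ) : l n ≤ ∑ b ∈ Finset.range (n + 1), 1 / (b : ℝ) := by
  refine Finset.sum_le_sum_of_subset_of_nonneg (fun i hi => ?_) fun _ _ _ => by positivity
  have := (Finset.mem_Ico.1 hi).2
  exact Finset.mem_range.2 (by omega)

/-- Half of the margin `1 - 2p` pays for the logarithms: they are bounded by powers with exponent `η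
= δ / p`, whose `p`-th power is `n^δ`. -/
theorem exists_lintegral_rieszSum_le {p : ℝ} (hp0 : 0 < p) (hp : p < 1 / 2) (B : ℕ) :
    ∃ C : ℝ, 0 ≤ C ∧ ∀ (m : ℕ → ℕ) [∀ k, NeZero (m k)], (∀ k, 2 ≤ m k) → (∀ k, m k ≤ B) →
      ∀ (N : ℕ) (y : Group m) (A : ℝ) (a : Group m → ℂ), IsAtom N y A a → 0 < A →
        ∀ n, 1 ≤ n → ∫⁻ x, ‖rieszSum n a x‖ₑ ^ p ∂haar m ≤
          ENNReal.ofReal (C * (A ^ p * growth ((1 - 2 * p) / 2) (M m N) n * (M m N : ℝ)⁻¹)) := by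
  set δ : ℝ := (1 - 2 * p) / 2 with hδ
  have hδ0 : 0 < δ := by rw [hδ]; linarith
  set η : ℝ := δ / p with hη
  have hη0 : 0 < η := by positivity
  have hηp : η * p = δ := div_mul_cancel₀ _ hp0.ne'
  set Z : ℝ := ∑' b : ℕ, 1 / (b : ℝ) ^ (1 + η) with hZ
  have hZ1 : 1 ≤ Z := by
    have := sum_one_div_le hη0 1
    simpa [Finset.sum_range_succ, hZ] using this
  have hZ0 : 0 < Z := by linarith
  set D : ℝ := (2 * (B : ℝ) ^ 2) ^ p * B * ∑' i : ℕ, (i : ℝ) * ((2 : ℝ) ^ (2 * p - 1)) ^ i with hD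
  have hD0 : 0 ≤ D := mul_nonneg (by positivity) (tsum_nonneg fun i => by positivity)
  refine ⟨Z ^ p * (2 + D), by positivity, ?_⟩
  intro m _ hm hB N y A a ha hA n hn
  have hn0 : (0 : ℝ) < n := by exact_mod_cast hn
  have hM : (0 : ℝ) < M m N := by exact_mod_cast M_pos (m := m) N
  rw [← lintegral_add_compl _ (measurableSet_interval m N y)]
  have h1 : ∫⁻ x in interval m N y, ‖rieszSum n a x‖ₑ ^ p ∂haar m ≤
      ENNReal.ofReal (Z ^ p * 2 * (A ^ p * (n : ℝ) ^ δ * (M m N : ℝ)⁻¹)) := by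
    refine (ha.setLIntegral_interval_le hm hA hp0 (by linarith) (n := n) (h := Z * (n : ℝ) ^ η)
      (by positivity) ((l_le_sum n).trans (sum_one_div_le hη0 n))).trans (le_of_eq ?_)
    congr 1
    rw [Real.mul_rpow hA.le (by positivity), Real.mul_rpow hZ0.le (by positivity),
      ← Real.rpow_mul hn0.le, hηp]
    ring
  have h2 : ∫⁻ x in (interval m N y)ᶜ, ‖rieszSum n a x‖ₑ ^ p ∂haar m ≤
      ENNReal.ofReal (Z ^ p * D * (A ^ p *
        (if M m N ≤ n then (M m N : ℝ) ^ δ * (n : ℝ) ^ δ else 0) * (M m N : ℝ)⁻¹)) := by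
    split_ifs with hMn
    · have hQ : ∑ b ∈ Finset.range (n / M m N + 1), 1 / (b : ℝ) ≤ Z * (n / M m N : ℝ) ^ η := by
        refine (sum_one_div_le hη0 _).trans ?_
        gcongr
        exact Nat.cast_div_le
      refine (ha.setLIntegral_compl_le hm hB hp0 hp n
        (mul_le_mul_of_nonneg_left hQ (by positivity))).trans (le_of_eq ?_)
      congr 1
      have h3 : (2 * (B : ℝ) ^ 2 * (A / (M m N : ℝ) ^ 2 * (Z * (n / M m N : ℝ) ^ η))) ^ p =
          (2 * (B : ℝ) ^ 2) ^ p * (Z ^ p * (A ^ p *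
            ((M m N : ℝ) ^ δ * (n : ℝ) ^ δ) * (M m N : ℝ)⁻¹)) := by
        rw [Real.mul_rpow (x := 2 * (B : ℝ) ^ 2) (by positivity) (by positivity),
          Real.mul_rpow (x := A / (M m N : ℝ) ^ 2) (by positivity) (by positivity),
          Real.mul_rpow hZ0.le (by positivity),
          Real.div_rpow hA.le (by positivity), ← Real.rpow_mul (by positivity), hηp,
          Real.div_rpow hn0.le hM.le, ← Real.rpow_natCast (M m N : ℝ) 2, ← Real.rpow_mul hM.le]
        -- The exponents cancel since `2p + 2δ = 1`: this turns `M_N^{-2p-δ}` into `M_N^δ` times the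
        -- measure `M_N⁻¹` of the interval.
        have h4 : (M m N : ℝ) ^ δ * (M m N : ℝ)⁻¹ *
            ((M m N : ℝ) ^ (((2 : ℕ) : ℝ) * p) * (M m N : ℝ) ^ δ) = 1 := by
          rw [← Real.rpow_neg_one (M m N : ℝ), ← Real.rpow_add hM, ← Real.rpow_add hM,
            ← Real.rpow_add hM]
          have : δ + -1 + (((2 : ℕ) : ℝ) * p + δ) = 0 := by rw [hδ]; push_cast; ring
          rw [this, Real.rpow_zero]
        have h5 : 0 < (M m N : ℝ) ^ (((2 : ℕ) : ℝ) * p) := by positivity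
        have h6 : 0 < (M m N : ℝ) ^ δ := by positivity
        have h7 : (M m N : ℝ) ^ δ * (M m N : ℝ)⁻¹ =
            1 / ((M m N : ℝ) ^ (((2 : ℕ) : ℝ) * p) * (M m N : ℝ) ^ δ) :=
          eq_one_div_of_mul_eq_one_left h4
        calc _ = (2 * (B : ℝ) ^ 2) ^ p * (Z ^ p * (A ^ p * (n : ℝ) ^ δ *
              (1 / ((M m N : ℝ) ^ (((2 : ℕ) : ℝ) * p) * (M m N : ℝ) ^ δ)))) := by
              field_simp
          _ = _ := by rw [← h7]; ring
      rw [h3, hD]; ring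
    -- For `n < M_N` only the vanishing block `b = 0` occurs, so `G = 0` is allowed.
    · have hQ : n / M m N = 0 := Nat.div_eq_of_lt (not_le.1 hMn)
      refine (ha.setLIntegral_compl_le hm hB hp0 hp n (G := 0) (by simp [hQ])).trans (le_of_eq ?_)
      simp [Real.zero_rpow hp0.ne']
  refine (add_le_add h1 h2).trans ?_
  have h8 : 0 ≤ if M m N ≤ n then (M m N : ℝ) ^ δ * (n : ℝ) ^ δ else 0 := by
    split_ifs <;> positivity
  rw [← ENNReal.ofReal_add (by positivity) (by positivity)]
  refine ENNReal.ofReal_le_ofReal ?_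
  rw [growth]
  have h9 : 0 ≤ Z ^ p * D * (A ^ p * (n : ℝ) ^ δ * (M m N : ℝ)⁻¹) := by positivity
  have h10 : 0 ≤ Z ^ p * 2 * (A ^ p *
      (if M m N ≤ n then (M m N : ℝ) ^ δ * (n : ℝ) ^ δ else 0) * (M m N : ℝ)⁻¹) := by positivity
  linarith

/-- The `p`-th powers of the Riesz sums dominating the maximal function of the `n`-th one. -/
def rieszPow {m : ℕ → ℕ} (p : ℝ) (n : ℕ) (g : Group m → ℂ) (x : Group m) : ℝ≥0∞ :=
  ‖rieszSum n g x‖ₑ ^ p +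
    ∑ j ∈ (Finset.range n).filter (fun j => M m j ≤ n), ‖rieszSum (M m j) g x‖ₑ ^ p

theorem measurable_enorm_rieszSum_rpow {m : ℕ → ℕ} [∀ k, NeZero (m k)] (hm : ∀ k, 2 ≤ m k)
    (p : ℝ) (n : ℕ) (g : Group m → ℂ) : Measurable fun x => ‖rieszSum n g x‖ₑ ^ p :=
  ((isLevel_rieszSum hm (lt_M hm n).le g).comp fun z => ‖z‖ₑ ^ p).measurable

theorem measurable_rieszPow {m : ℕ → ℕ} [∀ k, NeZero (m k)] (hm : ∀ k, 2 ≤ m k)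
    (p : ℝ) (n : ℕ) (g : Group m → ℂ) : Measurable (rieszPow p n g) :=
  (measurable_enorm_rieszSum_rpow hm p n g).add
    (Finset.measurable_sum _ fun _ _ => measurable_enorm_rieszSum_rpow hm p _ g)

/-- The weighted sum of the theorem for an atom. -/
theorem exists_sum_lintegral_rieszPow_le {p : ℝ} (hp0 : 0 < p) (hp : p < 1 / 2) (B : ℕ) :
    ∃ C : ℝ, 0 ≤ C ∧ ∀ (m : ℕ → ℕ) [∀ k, NeZero (m k)], (∀ k, 2 ≤ m k) → (∀ k, m k ≤ B) →
      ∀ (N : ℕ) (y : Group m) (A : ℝ) (a : Group m → ℂ), IsAtom N y A a → 0 < A →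
        ∀ R : ℕ, ∑ n ∈ Finset.Ico 1 R, ENNReal.ofReal ((n : ℝ) ^ (2 * p - 2)) *
          ∫⁻ x, rieszPow p n a x ∂haar m ≤
          ENNReal.ofReal (C * A ^ p) * haar m (interval m N y) := by
  obtain ⟨C, hC0, hC⟩ := exists_lintegral_rieszSum_le hp0 hp B
  set δ : ℝ := (1 - 2 * p) / 2 with hδ
  have hδ0 : 0 < δ := by rw [hδ]; linarith
  have h2 : (2 : ℝ) ^ (-δ) < 1 :=
    Real.rpow_lt_one_of_one_lt_of_neg one_lt_two (neg_lt_zero.2 hδ0)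
  set c : ℝ := (1 - 2 ^ (-δ))⁻¹ with hc
  have hc0 : 0 < c := inv_pos.2 (by linarith)
  refine ⟨C * (1 + c) * (2 * (2 * (1 + δ) / δ)), by positivity, ?_⟩
  intro m _ hm hB N y A a ha hA R
  have hM : (0 : ℝ) < M m N := by exact_mod_cast M_pos (m := m) N
  have h1 : ∀ n, 1 ≤ n → ∫⁻ x, rieszPow p n a x ∂haar m ≤ ENNReal.ofReal
      (C * (1 + c) * (A ^ p * growth δ (M m N) n * (M m N : ℝ)⁻¹)) := by
    intro n hn
    simp only [rieszPow]
    rw [lintegral_add_left (measurable_enorm_rieszSum_rpow hm p n a),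
      lintegral_finsetSum _ fun j _ => measurable_enorm_rieszSum_rpow hm p _ a]
    have hg := fun n => growth_nonneg δ (M m N) n
    calc _ ≤ ENNReal.ofReal (C * (A ^ p * growth δ (M m N) n * (M m N : ℝ)⁻¹)) +
          ∑ j ∈ (Finset.range n).filter (fun j => M m j ≤ n),
            ENNReal.ofReal (C * (A ^ p * growth δ (M m N) (M m j) * (M m N : ℝ)⁻¹)) :=
          add_le_add (hC m hm hB N y A a ha hA n hn)
            (Finset.sum_le_sum fun j _ => hC m hm hB N y A a ha hA _ (M_pos j))
      _ = ENNReal.ofReal (C * (A ^ p * growth δ (M m N) n * (M m N : ℝ)⁻¹) +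
          C * A ^ p * (M m N : ℝ)⁻¹ *
            ∑ j ∈ (Finset.range n).filter (fun j => M m j ≤ n), growth δ (M m N) (M m j)) := by
          have h3 : ∀ j, 0 ≤ C * (A ^ p * growth δ (M m N) (M m j) * (M m N : ℝ)⁻¹) := fun j => by
            have := hg (M m j); positivity
          rw [← ENNReal.ofReal_sum_of_nonneg fun j _ => h3 j, ← ENNReal.ofReal_add
            (by have := hg n; positivity) (Finset.sum_nonneg fun j _ => h3 j)]
          congr 2
          rw [Finset.mul_sum]
          exact Finset.sum_congr rfl fun j _ => by ring
      _ ≤ _ := by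
          refine ENNReal.ofReal_le_ofReal ?_
          calc _ ≤ C * (A ^ p * growth δ (M m N) n * (M m N : ℝ)⁻¹) +
                C * A ^ p * (M m N : ℝ)⁻¹ * (c * growth δ (M m N) n) := by
                gcongr
                exact sum_growth_le hδ0 hm _ n
            _ = _ := by ring
  calc _ ≤ ∑ n ∈ Finset.Ico 1 R, ENNReal.ofReal ((n : ℝ) ^ (-1 - 2 * δ) *
        (C * (1 + c) * (A ^ p * growth δ (M m N) n * (M m N : ℝ)⁻¹))) := by
        refine Finset.sum_le_sum fun n hn => ?_
        have : 2 * p - 2 = -1 - 2 * δ := by rw [hδ]; ring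
        rw [ENNReal.ofReal_mul (by positivity), this]
        gcongr
        exact h1 n (Finset.mem_Ico.1 hn).1
    _ = ENNReal.ofReal (C * (1 + c) * (A ^ p * (M m N : ℝ)⁻¹) *
        ∑ n ∈ Finset.Ico 1 R, (n : ℝ) ^ (-1 - 2 * δ) * growth δ (M m N) n) := by
        rw [← ENNReal.ofReal_sum_of_nonneg fun n _ => by
          have := growth_nonneg δ (M m N) n; positivity]
        rw [Finset.mul_sum]
        congr 1
        exact Finset.sum_congr rfl fun j _ => by ring
    _ ≤ ENNReal.ofReal (C * (1 + c) * (A ^ p * (M m N : ℝ)⁻¹) * (2 * (2 * (1 + δ) / δ))) := by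
        refine ENNReal.ofReal_le_ofReal ?_
        gcongr
        exact sum_weight_mul_growth_le hδ0 (M_pos N) R
    _ = _ := by
        rw [haar_interval, ← ENNReal.ofReal_natCast, ← ENNReal.ofReal_inv_of_pos hM,
          ← ENNReal.ofReal_mul (by positivity)]
        congr 1
        ring

/-- Subadditivity of the `p`-th powers, `p ≤ 1`. -/
theorem rpow_sum_le_sum_rpow {ι : Type*} (s : Finset ι) (g : ι → ℝ≥0∞) {p : ℝ} (hp0 : 0 < p)
    (hp1 : p ≤ 1) : (∑ i ∈ s, g i) ^ p ≤ ∑ i ∈ s, g i ^ p := by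
  classical
  induction s using Finset.induction_on with
  | empty => simp [hp0]
  | insert a s ha ih =>
    rw [Finset.sum_insert ha, Finset.sum_insert ha]
    exact (ENNReal.rpow_add_le_add_rpow _ _ hp0.le hp1).trans (by gcongr)

theorem rieszPow_sum_le {m : ℕ → ℕ} [∀ k, NeZero (m k)] (hm : ∀ k, 2 ≤ m k) {p : ℝ} (hp0 : 0 < p)
    (hp1 : p ≤ 1) {ι : Type*} {s : Finset ι} {g : ι → Group m → ℂ}
    (hg : ∀ i ∈ s, Integrable (g i) (haar m)) (n : ℕ) (x : Group m) :
    rieszPow p n (fun x => ∑ i ∈ s, g i x) x ≤ ∑ i ∈ s, rieszPow p n (g i) x := by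
  have h : ∀ n, ‖rieszSum n (fun x => ∑ i ∈ s, g i x) x‖ₑ ^ p ≤
      ∑ i ∈ s, ‖rieszSum n (g i) x‖ₑ ^ p := by
    intro n
    rw [rieszSum_sum hm hg]
    exact (ENNReal.rpow_le_rpow (enorm_sum_le _ _) hp0.le).trans
      (rpow_sum_le_sum_rpow _ _ hp0 hp1)
  simp only [rieszPow]
  rw [Finset.sum_add_distrib, Finset.sum_comm]
  exact add_le_add (h n) (Finset.sum_le_sum fun j _ => h _)

end AtomBound

/-! ### The atomic decomposition -/

section Stopping

variable {m : ℕ → ℕ} {f : ℕ → Group m → ℂ} {t : ℝ}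

/-- The first `n` steps of the martingale, looking one step ahead, do not exceed `t`. -/
def Calm (f : ℕ → Group m → ℂ) (t : ℝ) (n : ℕ) (x : Group m) : Prop :=
  ∀ j < n, ∀ y ∈ interval m j x, ‖f (j + 1) y‖ ≤ t

theorem Calm.anti {n k : ℕ} (h : n ≤ k) {x : Group m} (hk : Calm f t k x) : Calm f t n x :=
  fun j hj => hk j (hj.trans_le h)

theorem Calm.mono {n : ℕ} {t' : ℝ} (h : t ≤ t') {x : Group m} (hk : Calm f t n x) :
    Calm f t' n x :=
  fun j hj y hy => (hk j hj y hy).trans h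

/-- Looking ahead over all of `I_j(x)` makes the condition predictable: whether step `j + 1` is
taken is known at time `j`. -/
theorem isLevel_calm {n k : ℕ} (h : n ≤ k + 1) : IsLevel k (Calm f t n) := by
  intro x y hy
  simp only [Calm, eq_iff_iff]
  refine forall_congr' fun j => forall_congr' fun hj => ?_
  rw [interval_eq_of_mem (interval_anti (by omega : j ≤ k) x hy)]

/-- The martingale is stopped exactly at `n`. -/
def StopsAt (f : ℕ → Group m → ℂ) (t : ℝ) (n : ℕ) (x : Group m) : Prop :=
  Calm f t n x ∧ ¬ Calm f t (n + 1) x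

theorem isLevel_stopsAt (n : ℕ) : IsLevel n (StopsAt f t n) :=
  (isLevel_calm (Nat.le_succ n)).comp₂ (isLevel_calm le_rfl) fun P Q => P ∧ ¬ Q

open Classical in
theorem sum_ite_stopsAt {α : Type*} [AddCommMonoid α] (N : ℕ) (x : Group m) (d : α) :
    ∑ n ∈ Finset.range N, (if StopsAt f t n x then d else 0) = if Calm f t N x then 0 else d := by
  induction N with
  | zero => simp [Calm]
  | succ N ih =>
    rw [Finset.sum_range_succ, ih]
    by_cases h1 : Calm f t (N + 1) x
    · have h2 := h1.anti (Nat.le_succ N)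
      simp [StopsAt, h1, h2]
    · by_cases h2 : Calm f t N x <;> simp [StopsAt, h1, h2]

open Classical in
/-- The martingale stopped before its values exceed `t`, at time `N`. -/
def stopped (f : ℕ → Group m → ℂ) (N : ℕ) (t : ℝ) (x : Group m) : ℂ :=
  f 0 x + ∑ j ∈ Finset.range N, if Calm f t (j + 1) x then f (j + 1) x - f j x else 0

theorem stopped_eq_of_calm {N : ℕ} {x : Group m} (h : Calm f t N x) : stopped f N t x = f N x := by
  have h1 := Finset.sum_range_sub (fun j => f j x) N
  rw [stopped, Finset.sum_congr rfl fun j hj => if_pos (h.anti (Finset.mem_range.1 hj)), h1]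
  ring

/-- A step is taken only if its outcome is at most `t`, and the value is frozen afterwards. -/
theorem norm_stopped_le (h0 : ∀ x, ‖f 0 x‖ ≤ t) (N : ℕ) (x : Group m) :
    ‖stopped f N t x‖ ≤ t := by
  induction N with
  | zero => simpa [stopped] using h0 x
  | succ N ih =>
    by_cases h : Calm f t (N + 1) x
    · rw [stopped_eq_of_calm h]
      exact h N (Nat.lt_succ_self N) x (mem_interval_self N x)
    · have : stopped f (N + 1) t x = stopped f N t x := by
        rw [stopped, stopped, Finset.sum_range_succ, if_neg h, add_zero]
      rwa [this]

theorem isLevel_stopped (hf : ∀ n, IsLevel n (f n)) (N : ℕ) (t : ℝ) :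
    IsLevel N (stopped f N t) := by
  classical
  refine IsLevel.comp₂ ((hf 0).mono (Nat.zero_le N)) (IsLevel.sum fun j hj => ?_) (· + ·)
  have hj := Finset.mem_range.1 hj
  intro x y hy
  have h1 : Calm f t (j + 1) y = Calm f t (j + 1) x := isLevel_calm (by omega) x y hy
  simp only [h1, (hf (j + 1)).mono (by omega : j + 1 ≤ N) x y hy, (hf j).mono hj.le x y hy]

variable [∀ k, NeZero (m k)]

open Classical in
theorem sum_reps_indicator {α : Type*} [AddCommMonoid α] (n : ℕ) (g : Group m → α) (x : Group m) :
    ∑ r ∈ (reps m n).filter (fun r => StopsAt f t n r), (interval m n r).indicator g x =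
      if StopsAt f t n x then g x else 0 := by
  have hlev : StopsAt f t n (truncate n x) = StopsAt f t n x :=
    isLevel_stopsAt n _ _ (truncate_mem_interval n x)
  have hne : ∀ r ∈ reps m n, r ≠ truncate n x → (interval m n r).indicator g x = 0 :=
    fun r hr hne => Set.indicator_of_notMem (fun hx => hne (eq_truncate_of_mem_reps hr hx)) g
  by_cases h : StopsAt f t n x
  · rw [if_pos h, Finset.sum_eq_single_of_mem (truncate n x)
      (Finset.mem_filter.2 ⟨truncate_mem_reps n x, hlev.mpr h⟩)
      fun r hr => hne r (Finset.mem_filter.1 hr).1]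
    exact Set.indicator_of_mem (mem_interval_comm.1 (truncate_mem_interval n x)) g
  · rw [if_neg h]
    refine Finset.sum_eq_zero fun r hr => hne r (Finset.mem_filter.1 hr).1 ?_
    rintro rfl
    exact h (hlev.mp (Finset.mem_filter.1 hr).2)

open Classical in
-- Where `f` never stops at level `t`, both stopped functions equal `f N`. The remaining points lie
-- in exactly one stopping interval each.
theorem stopped_sub_eq_sum {t' : ℝ} (h : t ≤ t') (N : ℕ) (x : Group m) :
    stopped f N t' x - stopped f N t x = ∑ n ∈ Finset.range N,
      ∑ r ∈ (reps m n).filter (fun r => StopsAt f t n r),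
        (interval m n r).indicator (fun x => stopped f N t' x - stopped f N t x) x := by
  simp only [sum_reps_indicator, sum_ite_stopsAt]
  split_ifs with hc
  · rw [stopped_eq_of_calm hc, stopped_eq_of_calm (hc.mono h), sub_self]
  · rfl

/-- On a stopping interval the increments before time `n` cancel and those of the lower level are
absent afterwards. What survives is martingale increments restricted to sets known at their starting
time, each of integral zero. -/
theorem setIntegral_stopped_sub (hf : Martingale f (filtration m) (haar m)) {t' : ℝ} (h : t ≤ t')
    {n N : ℕ} (hn : n < N) {r : Group m} (hr : StopsAt f t n r) :
    ∫ x in interval m n r, (stopped f N t' x - stopped f N t x) ∂haar m = 0 := by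
  classical
  have hlev := isLevel_martingale hf
  have h1 : ∀ x ∈ interval m n r, stopped f N t' x - stopped f N t x =
      ∑ j ∈ Finset.Ico n N, {x | Calm f t' (j + 1) x}.indicator
        (fun x => f (j + 1) x - f j x) x := by
    intro x hx
    have hxs : StopsAt f t n x := (isLevel_stopsAt n _ _ hx).mpr hr
    rw [stopped, stopped, add_sub_add_left_eq_sub, ← Finset.sum_sub_distrib, Finset.range_eq_Ico,
      ← Finset.sum_Ico_consecutive _ (Nat.zero_le n) hn.le, Finset.sum_eq_zero, zero_add]
    · refine Finset.sum_congr rfl fun j hj => ?_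
      have : ¬ Calm f t (j + 1) x := fun hc =>
        hxs.2 (hc.anti (Nat.succ_le_succ (Finset.mem_Ico.1 hj).1))
      rw [if_neg this, sub_zero, Set.indicator_apply]
      rfl
    · intro j hj
      have : Calm f t (j + 1) x := hxs.1.anti (Finset.mem_Ico.1 hj).2
      rw [if_pos this, if_pos (this.mono h), sub_self]
  have hcalm : ∀ j, MeasurableSet {x | Calm f t' (j + 1) x} := fun j =>
    IsLevel.measurableSet (n := j) (isLevel_calm le_rfl)
  have hint : ∀ j, Integrable (f j) (haar m) := fun j => (hlev j).integrable
  have hdiff : ∀ j, Integrable ({x | Calm f t' (j + 1) x}.indicator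
      fun x => f (j + 1) x - f j x) (haar m) := fun j =>
    ((hint (j + 1)).sub (hint j)).indicator (hcalm j)
  rw [setIntegral_congr_fun (measurableSet_interval m n r) h1,
    integral_finsetSum _ fun j _ => (hdiff j).integrableOn]
  refine Finset.sum_eq_zero fun j hj => ?_
  rw [setIntegral_indicator (hcalm j),
    integral_sub (hint (j + 1)).integrableOn (hint j).integrableOn, sub_eq_zero]
  refine martingale_setIntegral_eq hf (Nat.le_succ j) le_rfl ?_
  exact ((isLevel_mem_interval n r).mono (Finset.mem_Ico.1 hj).1).comp₂
    (isLevel_calm (f := f) (t := t') le_rfl) (· ∧ ·)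

theorem isAtom_stopped_sub (hf : Martingale f (filtration m) (haar m)) {t' : ℝ} (h : t ≤ t')
    (h0 : ∀ x, ‖f 0 x‖ ≤ t) {n N : ℕ} (hn : n < N) {r : Group m} (hr : StopsAt f t n r) :
    IsAtom n r (t' + t)
      ((interval m n r).indicator fun x => stopped f N t' x - stopped f N t x) where
  level := by
    have hlev := isLevel_martingale hf
    exact ⟨N, isLevel_indicator ((isLevel_mem_interval n r).mono hn.le)
      ((isLevel_stopped hlev N t').comp₂ (isLevel_stopped hlev N t) (· - ·))⟩
  supp x hx := Set.indicator_of_notMem hx _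
  bound x := by
    refine (norm_indicator_le_norm_self _ _).trans ((norm_sub_le _ _).trans ?_)
    exact add_le_add (norm_stopped_le (fun x => (h0 x).trans h) N x) (norm_stopped_le h0 N x)
  mean := by
    right
    rw [integral_indicator (measurableSet_interval m n r)]
    exact setIntegral_stopped_sub hf h hn hr

/-- Stopping at `n` is caused by a subinterval of level `n + 1` on which `f` exceeds `t`, and this
subinterval has at least the fraction `1 / B` of the measure. -/
theorem haar_interval_le_of_stopsAt (hf : Martingale f (filtration m) (haar m)) {B : ℕ}
    (hB : ∀ k, m k ≤ B) (ht : 0 ≤ t) {n : ℕ} {r : Group m} (hr : StopsAt f t n r) :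
    haar m (interval m n r) ≤
      B * haar m (interval m n r ∩ {x | ENNReal.ofReal t < ⨆ n, ‖f n x‖ₑ}) := by
  have hex : ∃ y ∈ interval m n r, t < ‖f (n + 1) y‖ := by
    by_contra! hcon
    refine hr.2 fun j hj y hy => ?_
    rcases Nat.lt_succ_iff_lt_or_eq.1 hj with h | rfl
    · exact hr.1 j h y hy
    · exact hcon y hy
  obtain ⟨y, hy, hty⟩ := hex
  have hsub : interval m (n + 1) y ⊆
      interval m n r ∩ {x | ENNReal.ofReal t < ⨆ n, ‖f n x‖ₑ} := by
    intro x hx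
    refine ⟨?_, ?_⟩
    · rw [← interval_eq_of_mem hy]
      exact interval_anti (Nat.le_succ n) y hx
    · refine lt_of_lt_of_le ?_ (le_iSup (fun n => ‖f n x‖ₑ) (n + 1))
      rw [← ofReal_norm, isLevel_martingale hf (n + 1) y x hx]
      exact (ENNReal.ofReal_lt_ofReal_iff (ht.trans_lt hty)).2 hty
  refine le_trans ?_ (mul_le_mul_right (measure_mono hsub) _)
  rw [haar_interval, haar_interval, M_succ]
  have h1 : (m n : ℝ≥0∞) ≠ 0 := by exact_mod_cast NeZero.ne (m n)
  have h2 : (m n : ℝ≥0∞) ≠ ∞ := ENNReal.natCast_ne_top _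
  calc (M m n : ℝ≥0∞)⁻¹ = m n * ((M m n * m n : ℕ) : ℝ≥0∞)⁻¹ := by
        rw [Nat.cast_mul, ENNReal.mul_inv (Or.inr h2) (Or.inr h1), mul_left_comm,
          ENNReal.mul_inv_cancel h1 h2, mul_one]
    _ ≤ _ := by
        gcongr
        exact hB n

open Classical in
-- The stopping intervals are disjoint, so their intersections with `{f^* > t}` add up to at most
-- its measure.
theorem sum_haar_interval_le (hf : Martingale f (filtration m) (haar m)) {B : ℕ}
    (hB : ∀ k, m k ≤ B) (ht : 0 ≤ t) (N : ℕ) :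
    ∑ n ∈ Finset.range N, ∑ r ∈ (reps m n).filter (fun r => StopsAt f t n r),
      haar m (interval m n r) ≤ B * haar m {x | ENNReal.ofReal t < ⨆ n, ‖f n x‖ₑ} := by
  set E : Set (Group m) := {x | ENNReal.ofReal t < ⨆ n, ‖f n x‖ₑ} with hE
  calc _ ≤ ∑ n ∈ Finset.range N, ∑ r ∈ (reps m n).filter (fun r => StopsAt f t n r),
        B * (haar m).restrict E (interval m n r) := by
        refine Finset.sum_le_sum fun n _ => Finset.sum_le_sum fun r hr => ?_
        rw [Measure.restrict_apply (measurableSet_interval m n r)]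
        exact haar_interval_le_of_stopsAt hf hB ht (Finset.mem_filter.1 hr).2
    _ = B * ∫⁻ x, ∑ n ∈ Finset.range N, ∑ r ∈ (reps m n).filter (fun r => StopsAt f t n r),
        (interval m n r).indicator (fun _ => (1 : ℝ≥0∞)) x ∂(haar m).restrict E := by
        have hmeas : ∀ n (r : Group m),
            Measurable ((interval m n r).indicator fun _ => (1 : ℝ≥0∞)) := fun n r =>
          measurable_const.indicator (measurableSet_interval m n r)
        rw [lintegral_finsetSum _ fun n _ => Finset.measurable_sum _ fun r _ => hmeas n r,
          Finset.mul_sum]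
        refine Finset.sum_congr rfl fun n _ => ?_
        rw [lintegral_finsetSum _ fun r _ => hmeas n r, Finset.mul_sum]
        refine Finset.sum_congr rfl fun r _ => ?_
        rw [lintegral_indicator_const (measurableSet_interval m n r), one_mul]
    _ ≤ B * ∫⁻ _, 1 ∂(haar m).restrict E := by
        gcongr with x
        simp only [sum_reps_indicator, sum_ite_stopsAt]
        split_ifs <;> simp
    _ = _ := by simp

end Stopping

/-! ### The theorem -/

section Main

/-- The weighted sum of the integrals of `rieszPow`. -/
def weightedSum {m : ℕ → ℕ} (p : ℝ) (R : ℕ) (g : Group m → ℂ) : ℝ≥0∞ :=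
  ∑ n ∈ Finset.Ico 1 R, ENNReal.ofReal ((n : ℝ) ^ (2 * p - 2)) * ∫⁻ x, rieszPow p n g x ∂haar m

theorem weightedSum_sum_le {m : ℕ → ℕ} [∀ k, NeZero (m k)] (hm : ∀ k, 2 ≤ m k) {p : ℝ}
    (hp0 : 0 < p) (hp1 : p ≤ 1) {ι : Type*} {s : Finset ι} {g : ι → Group m → ℂ}
    (hg : ∀ i ∈ s, Integrable (g i) (haar m)) (R : ℕ) :
    weightedSum p R (fun x => ∑ i ∈ s, g i x) ≤ ∑ i ∈ s, weightedSum p R (g i) := by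
  simp only [weightedSum]
  rw [Finset.sum_comm]
  refine Finset.sum_le_sum fun n _ => ?_
  rw [← Finset.mul_sum, ← lintegral_finsetSum _ fun i _ => measurable_rieszPow hm p n (g i)]
  gcongr with x
  exact rieszPow_sum_le hm hp0 hp1 hg n x

/-- Pointwise, the levels below `F x` are lacunary, so their `p`-th powers sum to a multiple of `F x
^ p`; the value `∞` is treated separately. -/
theorem sum_rpow_mul_measure_le {Ω : Type*} [MeasurableSpace Ω] (μ : Measure Ω) {F : Ω → ℝ≥0∞}
    (hF : Measurable F) {t : ℕ → ℝ} (ht0 : ∀ k, 0 < t k) (ht : ∀ k, 2 * t k ≤ t (k + 1)) {p : ℝ}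
    (hp : 0 < p) (K : ℕ) :
    ∑ i ∈ Finset.range K, ENNReal.ofReal (t i ^ p) * μ {x | ENNReal.ofReal (t i) < F x} ≤
      ENNReal.ofReal (1 - 2 ^ (-p))⁻¹ * ∫⁻ x, F x ^ p ∂μ := by
  classical
  have h2 : (2 : ℝ) ^ (-p) < 1 := Real.rpow_lt_one_of_one_lt_of_neg one_lt_two (neg_lt_zero.2 hp)
  have hc0 : 0 < (1 - (2 : ℝ) ^ (-p))⁻¹ := inv_pos.2 (by linarith)
  have hmeas : ∀ i, MeasurableSet {x | ENNReal.ofReal (t i) < F x} := fun i =>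
    measurableSet_lt measurable_const hF
  calc _ = ∫⁻ x, ∑ i ∈ Finset.range K, {x | ENNReal.ofReal (t i) < F x}.indicator
        (fun _ => ENNReal.ofReal (t i ^ p)) x ∂μ := by
        rw [lintegral_finsetSum _ fun i _ => measurable_const.indicator (hmeas i)]
        exact Finset.sum_congr rfl fun i _ => (lintegral_indicator_const (hmeas i) _).symm
    _ ≤ ∫⁻ x, ENNReal.ofReal (1 - 2 ^ (-p))⁻¹ * F x ^ p ∂μ := by
        refine lintegral_mono fun x => ?_
        rcases eq_or_ne (F x) ∞ with hx | hx
        · rw [hx, ENNReal.top_rpow_of_pos hp, ENNReal.mul_top (ENNReal.ofReal_pos.2 hc0).ne']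
          exact le_top
        · have h1 := sum_filter_rpow_lacunary_le ht0 ht hp
            (ENNReal.toReal_nonneg (a := F x)) K
          have h3 : ENNReal.ofReal ((1 - 2 ^ (-p))⁻¹ * (F x).toReal ^ p) =
              ENNReal.ofReal (1 - 2 ^ (-p))⁻¹ * F x ^ p := by
            rw [ENNReal.ofReal_mul hc0.le, ← ENNReal.ofReal_rpow_of_nonneg
              ENNReal.toReal_nonneg hp.le, ENNReal.ofReal_toReal hx]
          rw [← h3]
          refine le_trans ?_ (ENNReal.ofReal_le_ofReal h1)
          rw [ENNReal.ofReal_sum_of_nonneg fun i _ => Real.rpow_nonneg (ht0 i).le p,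
            Finset.sum_filter]
          refine Finset.sum_le_sum fun i _ => ?_
          rw [Set.indicator_apply]
          split_ifs with h4 h5
          · exact le_rfl
          · exact absurd (ENNReal.ofReal_le_iff_le_toReal hx |>.1 (le_of_lt h4)) h5
          · exact zero_le
          · exact le_rfl
    _ = _ := lintegral_const_mul _ (hF.pow_const p)

theorem measurable_maximal {m : ℕ → ℕ} [∀ k, NeZero (m k)] {f : ℕ → Group m → ℂ}
    (hf : ∀ n, IsLevel n (f n)) : Measurable fun x => ⨆ n, ‖f n x‖ₑ :=
  Measurable.iSup fun n => ((hf n).comp fun z => ‖z‖ₑ).measurable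

open Classical in
/-- The weighted sum of a martingale, through its atomic decomposition at the levels `t_i`. -/
theorem weightedSum_le_of_levels {p : ℝ} (hp0 : 0 < p) (hp1 : p ≤ 1) {B : ℕ} {C : ℝ}
    {m : ℕ → ℕ} [∀ k, NeZero (m k)] (hm : ∀ k, 2 ≤ m k) (hB : ∀ k, m k ≤ B) {R : ℕ}
    (hC : ∀ (N : ℕ) (y : Group m) (A : ℝ) (a : Group m → ℂ), IsAtom N y A a → 0 < A →
        weightedSum p R a ≤ ENNReal.ofReal (C * A ^ p) * haar m (interval m N y))
    {f : ℕ → Group m → ℂ} (hf : Martingale f (filtration m) (haar m)) (N : ℕ) {t : ℕ → ℝ}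
    (ht0 : ∀ i, 0 < t i) (ht : Monotone t) (h0 : ∀ x, ‖f 0 x‖ ≤ t 0) {K : ℕ}
    (hK : ∀ j ≤ N, ∀ x, ‖f j x‖ ≤ t K) :
    weightedSum p R (f N) ≤ ENNReal.ofReal (C * t 0 ^ p) +
      ∑ i ∈ Finset.range K, ENNReal.ofReal (C * (t (i + 1) + t i) ^ p) *
        (B * haar m {x | ENNReal.ofReal (t i) < ⨆ n, ‖f n x‖ₑ}) := by
  have hlev := isLevel_martingale hf
  have hst : ∀ s, Integrable (stopped f N s) (haar m) := fun s =>
    (isLevel_stopped hlev N s).integrable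
  let d : ℕ → Group m → ℂ := fun i x => stopped f N (t (i + 1)) x - stopped f N (t i) x
  have hdint : ∀ i, Integrable (d i) (haar m) := fun i => (hst _).sub (hst _)
  have h0' : ∀ i x, ‖f 0 x‖ ≤ t i := fun i x => (h0 x).trans (ht (Nat.zero_le i))
  let G : ℕ → Group m → ℂ := fun i => Nat.casesOn i (stopped f N (t 0)) d
  have hG : ∀ i ∈ Finset.range (K + 1), Integrable (G i) (haar m) := by
    rintro (_ | i) _
    · exact hst _
    · exact hdint i
  have hfN : f N = fun x => ∑ i ∈ Finset.range (K + 1), G i x := by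
    funext x
    -- At the top level nothing is stopped, so the telescoping sum ends at `f N`.
    have h1 : Calm f (t K) N x := fun j hj y _ => hK (j + 1) hj y
    have h2 := Finset.sum_range_sub (fun i => stopped f N (t i) x) K
    rw [← stopped_eq_of_calm h1, Finset.sum_range_succ']
    change _ = ∑ i ∈ Finset.range K, (stopped f N (t (i + 1)) x - stopped f N (t i) x) +
      stopped f N (t 0) x
    rw [h2]; ring
  rw [hfN]
  refine (weightedSum_sum_le hm hp0 hp1 hG R).trans ?_
  rw [Finset.sum_range_succ', add_comm]
  refine add_le_add ?_ (Finset.sum_le_sum fun i _ => ?_)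
  -- The lowest level is an atom on the whole group, where no mean-zero condition is imposed.
  · have hatom : IsAtom 0 0 (t 0) (stopped f N (t 0)) :=
      ⟨⟨N, isLevel_stopped hlev N _⟩, fun x hx => absurd (by rw [interval_zero]; trivial) hx,
        norm_stopped_le h0 N, Or.inl rfl⟩
    refine (hC 0 0 (t 0) _ hatom (ht0 0)).trans (le_of_eq ?_)
    rw [interval_zero, measure_univ, mul_one]
  · have hd : d i = fun x => ∑ n ∈ Finset.range N,
        ∑ r ∈ (reps m n).filter (fun r => StopsAt f (t i) n r),
          (interval m n r).indicator (d i) x :=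
      funext fun x => stopped_sub_eq_sum (ht (Nat.le_succ i)) N x
    have hind : ∀ n r, Integrable ((interval m n r).indicator (d i)) (haar m) := fun n r =>
      (hdint i).indicator (measurableSet_interval m n r)
    change weightedSum p R (d i) ≤ _
    rw [hd]
    refine (weightedSum_sum_le hm hp0 hp1 (fun n _ => integrable_finsetSum _
      fun r _ => hind n r) R).trans ?_
    calc _ ≤ ∑ n ∈ Finset.range N, ∑ r ∈ (reps m n).filter (fun r => StopsAt f (t i) n r),
          ENNReal.ofReal (C * (t (i + 1) + t i) ^ p) * haar m (interval m n r) := by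
          refine Finset.sum_le_sum fun n hn => ?_
          refine (weightedSum_sum_le hm hp0 hp1 (fun r _ => hind n r) R).trans ?_
          refine Finset.sum_le_sum fun r hr => hC n r _ _ ?_ (add_pos (ht0 _) (ht0 _))
          exact isAtom_stopped_sub hf (ht (Nat.le_succ i)) (h0' i) (Finset.mem_range.1 hn)
            (Finset.mem_filter.1 hr).2
      _ ≤ _ := by
          simp only [← Finset.mul_sum]
          gcongr
          exact sum_haar_interval_le hf hB (ht0 i).le N

/-- The levels are `(|f_0| + d) 2^i`, with `f_0` constant. The shift `d > 0` keeps them positive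
when `f_0 = 0`, and its contribution `C d^p` is arbitrarily small. -/
theorem exists_weightedSum_le {p : ℝ} (hp0 : 0 < p) (hp : p < 1 / 2) (B : ℕ) :
    ∃ C : ℝ≥0, ∀ (m : ℕ → ℕ) [∀ k, NeZero (m k)], (∀ k, 2 ≤ m k) → (∀ k, m k ≤ B) →
      ∀ f : ℕ → Group m → ℂ, Martingale f (filtration m) (haar m) → ∀ N R,
        weightedSum p R (f N) ≤ C * ∫⁻ x, (⨆ n, ‖f n x‖ₑ) ^ p ∂haar m := by
  obtain ⟨C, hC0, hC⟩ := exists_sum_lintegral_rieszPow_le hp0 hp B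
  set c : ℝ := (1 - 2 ^ (-p))⁻¹ with hc
  refine ⟨Real.toNNReal C + Real.toNNReal (C * 3 ^ p) * B * Real.toNNReal c, ?_⟩
  intro m _ hm hB f hf N R
  have hlev := isLevel_martingale hf
  have hp1 : p ≤ 1 := by linarith
  set J : ℝ≥0∞ := ∫⁻ x, (⨆ n, ‖f n x‖ₑ) ^ p ∂haar m with hJ
  have hf0 : ∀ x, f 0 x = f 0 0 := fun x => hlev 0 0 x (by rw [interval_zero]; trivial)
  have hroot : ENNReal.ofReal (‖f 0 0‖ ^ p) ≤ J := by
    calc ENNReal.ofReal (‖f 0 0‖ ^ p) = ∫⁻ _, ENNReal.ofReal (‖f 0 0‖ ^ p) ∂haar m := by simp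
      _ ≤ J := by
        refine lintegral_mono fun x => ?_
        rw [← ENNReal.ofReal_rpow_of_nonneg (norm_nonneg _) hp0.le, ofReal_norm, ← hf0 x]
        exact ENNReal.rpow_le_rpow (le_iSup (fun n => ‖f n x‖ₑ) 0) hp0.le
  have key : ∀ d : ℝ, 0 < d → weightedSum p R (f N) ≤
      ((Real.toNNReal C + Real.toNNReal (C * 3 ^ p) * B * Real.toNNReal c : ℝ≥0) : ℝ≥0∞) * J +
        ENNReal.ofReal (C * d ^ p) := by
    intro d hd
    have hε : 0 < ‖f 0 0‖ + d := by positivity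
    let t : ℕ → ℝ := fun i => (‖f 0 0‖ + d) * 2 ^ i
    have ht0 : ∀ i, 0 < t i := fun i => by positivity
    have ht2 : ∀ i, t (i + 1) = 2 * t i := fun i => by simp only [t]; ring
    have htm : Monotone t := monotone_nat_of_le_succ fun i => by
      rw [ht2]; linarith [ht0 i]
    have h0 : ∀ x, ‖f 0 x‖ ≤ t 0 := fun x => by
      rw [hf0 x]; simp only [t, pow_zero, mul_one]; linarith
    have hbd : ∃ D : ℝ, ∀ j ≤ N, ∀ x, ‖f j x‖ ≤ D := by
      choose D hD using fun j => (hlev j).exists_norm_le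
      refine ⟨∑ j ∈ Finset.range (N + 1), |D j|, fun j hj x => ?_⟩
      exact ((hD j x).trans (le_abs_self _)).trans (Finset.single_le_sum (f := fun j => |D j|)
        (fun _ _ => abs_nonneg _) (Finset.mem_range.2 (Nat.lt_succ_of_le hj)))
    obtain ⟨D, hD⟩ := hbd
    obtain ⟨K, hK⟩ := pow_unbounded_of_one_lt (D / (‖f 0 0‖ + d)) one_lt_two
    have hDK : D ≤ t K := by
      rw [div_lt_iff₀ hε] at hK
      simp only [t]
      linarith
    have h1 := weightedSum_le_of_levels hp0 hp1 hm hB (C := C) (R := R)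
      (fun N y A a ha hA => hC m hm hB N y A a ha hA R) hf N ht0 htm h0
      fun j hj x => (hD j hj x).trans hDK
    have h2 := sum_rpow_mul_measure_le (haar m) (measurable_maximal hlev) ht0
      (fun i => (ht2 i).ge) hp0 K
    have h3 : ENNReal.ofReal (C * t 0 ^ p) ≤
        ENNReal.ofReal C * J + ENNReal.ofReal (C * d ^ p) := by
      have h4 : t 0 ^ p ≤ ‖f 0 0‖ ^ p + d ^ p := by
        simp only [t, pow_zero, mul_one]
        exact Real.rpow_add_le_add_rpow (norm_nonneg _) hd.le hp0.le hp1
      calc _ ≤ ENNReal.ofReal (C * ‖f 0 0‖ ^ p + C * d ^ p) := by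
            refine ENNReal.ofReal_le_ofReal ?_
            rw [← mul_add]
            gcongr
        _ = ENNReal.ofReal C * ENNReal.ofReal (‖f 0 0‖ ^ p) + ENNReal.ofReal (C * d ^ p) := by
            rw [ENNReal.ofReal_add (by positivity) (by positivity), ENNReal.ofReal_mul hC0]
        _ ≤ _ := by gcongr
    have h5 : ∑ i ∈ Finset.range K, ENNReal.ofReal (C * (t (i + 1) + t i) ^ p) *
        (B * haar m {x | ENNReal.ofReal (t i) < ⨆ n, ‖f n x‖ₑ}) ≤
        ENNReal.ofReal (C * 3 ^ p) * B * ENNReal.ofReal c * J := by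
      calc _ = ENNReal.ofReal (C * 3 ^ p) * B * ∑ i ∈ Finset.range K,
            ENNReal.ofReal (t i ^ p) * haar m {x | ENNReal.ofReal (t i) < ⨆ n, ‖f n x‖ₑ} := by
            rw [Finset.mul_sum]
            refine Finset.sum_congr rfl fun i _ => ?_
            rw [ht2, show 2 * t i + t i = 3 * t i by ring,
              Real.mul_rpow (by norm_num) (ht0 i).le, ← mul_assoc C,
              ENNReal.ofReal_mul (by positivity)]
            ring
        _ ≤ ENNReal.ofReal (C * 3 ^ p) * B * (ENNReal.ofReal c * J) := by gcongr
        _ = _ := by ring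
    refine (h1.trans (add_le_add h3 h5)).trans (le_of_eq ?_)
    push_cast
    rw [ENNReal.ofReal, ENNReal.ofReal, ENNReal.ofReal, ENNReal.ofReal]
    ring
  refine ENNReal.le_of_forall_pos_le_add fun ε hε _ => ?_
  have hε' : (0 : ℝ) < ε := hε
  -- With this `d`, `C d^p = C ε / (C + 1) ≤ ε`; adding `1` covers `C = 0`.
  refine (key ((ε / (C + 1)) ^ p⁻¹) (by positivity)).trans ?_
  gcongr
  rw [← ENNReal.ofReal_coe_nnreal]
  refine ENNReal.ofReal_le_ofReal ?_
  rw [← Real.rpow_mul (by positivity), inv_mul_cancel₀ hp0.ne', Real.rpow_one, mul_div_assoc',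
    div_le_iff₀ (by positivity)]
  nlinarith

theorem log_le_l {n : ℕ} (hn : 1 ≤ n) : Real.log n ≤ l n := by
  induction n, hn using Nat.le_induction with
  | base => simp [l]
  | succ n hn ih =>
    have hn0 : (0 : ℝ) < n := by exact_mod_cast hn
    rw [l, Finset.sum_Ico_succ_top hn]
    have h1 : Real.log ((n + 1 : ℕ) : ℝ) = Real.log n + Real.log (1 + 1 / n) := by
      rw [← Real.log_mul hn0.ne' (by positivity)]
      congr 1
      push_cast
      field_simp
    have h2 := Real.log_le_sub_one_of_pos (show (0 : ℝ) < 1 + 1 / n by positivity)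
    rw [h1]
    unfold l at ih
    linarith

theorem hardyNorm_rpow {m : ℕ → ℕ} {p : ℝ} (hp0 : 0 < p) (f : ℕ → Group m → ℂ) :
    hardyNorm p f ^ p = ∫⁻ x, (⨆ n, ‖f n x‖ₑ) ^ p ∂haar m := by
  rw [hardyNorm, eLpNorm_eq_lintegral_rpow_enorm_toReal (by simpa using hp0) ENNReal.ofReal_ne_top,
    ENNReal.toReal_ofReal hp0.le, ← ENNReal.rpow_mul, one_div, inv_mul_cancel₀ hp0.ne',
    ENNReal.rpow_one]
  simp only [enorm_eq_self]

/-- The estimate of a single term. -/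
theorem term_le {m : ℕ → ℕ} [∀ k, NeZero (m k)] (hm : ∀ k, 2 ≤ m k) {p : ℝ} (hp0 : 0 < p)
    (hp1 : p ≤ 1) {f : ℕ → Group m → ℂ} (hf : Martingale f (filtration m) (haar m)) {n N : ℕ}
    (hn : 1 ≤ n) (h : n ≤ M m N) :
    ENNReal.ofReal (Real.log n ^ p / (n : ℝ) ^ (2 - 2 * p)) *
        hardyNorm p (regular (rieszMean f n)) ^ p ≤
      ENNReal.ofReal ((n : ℝ) ^ (2 * p - 2)) * ∫⁻ x, rieszPow p n (f N) x ∂haar m +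
        ENNReal.ofReal (l n ^ p * (n : ℝ) ^ (2 * p - 2)) *
          ∫⁻ x, (⨆ n, ‖f n x‖ₑ) ^ p ∂haar m := by
  have hl := l_nonneg n
  have hlog : 0 ≤ Real.log n := Real.log_natCast_nonneg n
  have hll := log_le_l hn
  have hpt : ∀ x, (⨆ k, ‖regular (rieszMean f n) k x‖ₑ) ^ p ≤
      ENNReal.ofReal ((l n)⁻¹ ^ p) * rieszPow p n (f N) x + (⨆ n, ‖f n x‖ₑ) ^ p := by
    intro x
    have h1 : ⨆ k, ‖regular (rieszMean f n) k x‖ₑ ≤ ENNReal.ofReal (l n)⁻¹ *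
        (‖rieszSum n (f N) x‖ₑ +
          ∑ j ∈ (Finset.range n).filter (fun j => M m j ≤ n), ‖rieszSum (M m j) (f N) x‖ₑ) +
        ⨆ n, ‖f n x‖ₑ := by
      refine iSup_le fun k => ?_
      have h2 := ENNReal.ofReal_le_ofReal (norm_regular_rieszMean_le hm hf h k x)
      have h3 : 0 ≤ ∑ j ∈ (Finset.range n).filter (fun j => M m j ≤ n),
        ‖rieszSum (M m j) (f N) x‖ := Finset.sum_nonneg fun _ _ => norm_nonneg _
      rw [ofReal_norm, ENNReal.ofReal_add (by positivity) (by split_ifs <;> positivity),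
        ENNReal.ofReal_mul (by positivity), ENNReal.ofReal_add (norm_nonneg _) h3,
        ENNReal.ofReal_sum_of_nonneg fun _ _ => norm_nonneg _] at h2
      simp only [ofReal_norm] at h2
      refine h2.trans ?_
      gcongr
      split_ifs
      · rw [ofReal_norm]
        exact le_iSup (fun n => ‖f n x‖ₑ) k
      · simp
    refine (ENNReal.rpow_le_rpow h1 hp0.le).trans ?_
    refine (ENNReal.rpow_add_le_add_rpow _ _ hp0.le hp1).trans ?_
    rw [ENNReal.mul_rpow_of_nonneg _ _ hp0.le,
      ENNReal.ofReal_rpow_of_nonneg (inv_nonneg.2 hl) hp0.le]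
    gcongr
    refine (ENNReal.rpow_add_le_add_rpow _ _ hp0.le hp1).trans ?_
    rw [rieszPow]
    gcongr
    exact rpow_sum_le_sum_rpow _ _ hp0 hp1
  have hw : Real.log n ^ p / (n : ℝ) ^ (2 - 2 * p) = Real.log n ^ p * (n : ℝ) ^ (2 * p - 2) := by
    rw [div_eq_mul_inv, ← Real.rpow_neg (Nat.cast_nonneg n), neg_sub]
  -- The logarithmic weight is spent here against the normalization `1 / l n`; at `n = 1` both
  -- factors are `0`.
  have h4 : Real.log n ^ p * (l n)⁻¹ ^ p ≤ 1 := by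
    rw [← Real.mul_rpow hlog (inv_nonneg.2 hl)]
    refine Real.rpow_le_one (by positivity) ?_ hp0.le
    exact (mul_le_mul_of_nonneg_right hll (inv_nonneg.2 hl)).trans mul_inv_le_one
  rw [hardyNorm_rpow hp0, hw]
  calc _ ≤ ENNReal.ofReal (Real.log n ^ p * (n : ℝ) ^ (2 * p - 2)) *
        (ENNReal.ofReal ((l n)⁻¹ ^ p) * ∫⁻ x, rieszPow p n (f N) x ∂haar m +
          ∫⁻ x, (⨆ n, ‖f n x‖ₑ) ^ p ∂haar m) := by
        gcongr
        refine (lintegral_mono hpt).trans (le_of_eq ?_)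
        rw [lintegral_add_left ((measurable_rieszPow hm p n (f N)).const_mul _),
          lintegral_const_mul _ (measurable_rieszPow hm p n (f N))]
    _ ≤ _ := by
        rw [mul_add, ← mul_assoc, ← ENNReal.ofReal_mul (by positivity)]
        gcongr
        calc _ = (Real.log n ^ p * (l n)⁻¹ ^ p) * (n : ℝ) ^ (2 * p - 2) := by ring
          _ ≤ _ := mul_le_of_le_one_left (by positivity) h4

/-- Handles the `f^*` part of the maximal function: `l n ^ p` costs at most a multiple of `n^δ`, and
`2p - 2 + δ = -1 - δ`. -/
theorem exists_sum_l_rpow_le {p : ℝ} (hp0 : 0 < p) (hp : p < 1 / 2) :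
    ∃ C : ℝ, ∀ R, ∑ n ∈ Finset.Ico 1 R, l n ^ p * (n : ℝ) ^ (2 * p - 2) ≤ C := by
  set δ : ℝ := (1 - 2 * p) / 2 with hδ
  have hδ0 : 0 < δ := by rw [hδ]; linarith
  set η : ℝ := δ / p with hη
  have hη0 : 0 < η := by positivity
  have hηp : η * p = δ := div_mul_cancel₀ _ hp0.ne'
  set Z : ℝ := ∑' b : ℕ, 1 / (b : ℝ) ^ (1 + η) with hZ
  have hZ0 : 0 ≤ Z := tsum_nonneg fun b => by positivity
  refine ⟨Z ^ p * (2 * (1 + δ) / δ), fun R => ?_⟩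
  calc _ ≤ ∑ n ∈ Finset.Ico 1 R, Z ^ p * (n : ℝ) ^ (-1 - δ) := by
        refine Finset.sum_le_sum fun n hn => ?_
        have hn0 : (0 : ℝ) < n := by exact_mod_cast (Finset.mem_Ico.1 hn).1
        have h1 := (l_le_sum n).trans (sum_one_div_le hη0 n)
        have h2 : l n ^ p ≤ Z ^ p * (n : ℝ) ^ δ := by
          refine (Real.rpow_le_rpow (l_nonneg n) h1 hp0.le).trans (le_of_eq ?_)
          rw [Real.mul_rpow hZ0 (by positivity), ← Real.rpow_mul hn0.le, hηp]
        calc _ ≤ Z ^ p * (n : ℝ) ^ δ * (n : ℝ) ^ (2 * p - 2) := by gcongr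
          _ = _ := by
            rw [mul_assoc, ← Real.rpow_add hn0]
            congr 2
            rw [hδ]; ring
    _ ≤ _ := by
        rw [← Finset.mul_sum]
        gcongr
        simpa using sum_rpow_tail_le hδ0 le_rfl R

end Main

end Vilenkin

end

theorem mainTheorem7 (p : ℝ) (hp0 : 0 < p) (hp : p < 1 / 2) (B : ℕ) :
    ∃ c : ℝ≥0, ∀ m : ℕ → ℕ, (∀ k, 2 ≤ m k ∧ m k ≤ B) →
      ∀ f : ℕ → Vilenkin.Group m → ℂ, Vilenkin.MemHardy p f →
        ∑' n : ℕ+, ENNReal.ofReal (Real.log (n : ℕ) ^ p / ((n : ℕ) : ℝ) ^ (2 - 2 * p)) *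
            Vilenkin.hardyNorm p (Vilenkin.regular (Vilenkin.rieszMean f n)) ^ p
          ≤ c * Vilenkin.hardyNorm p f ^ p := by
  obtain ⟨C₁, hC₁⟩ := Vilenkin.exists_weightedSum_le hp0 hp B
  obtain ⟨C₂, hC₂⟩ := Vilenkin.exists_sum_l_rpow_le hp0 hp
  refine ⟨C₁ + C₂.toNNReal, fun m hm f hf => ?_⟩
  have hm2 : ∀ k, 2 ≤ m k := fun k => (hm k).1
  have : ∀ k, NeZero (m k) := fun k => ⟨by have := hm2 k; omega⟩
  rw [ENNReal.tsum_eq_iSup_sum]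
  refine iSup_le fun s => ?_
  rw [Vilenkin.hardyNorm_rpow hp0 f]
  set J := ∫⁻ x, (⨆ n, ‖f n x‖ₑ) ^ p ∂Vilenkin.haar m
  -- One function `f R` serves all `n < R`, since `R < M_R`.
  let R : ℕ := s.sup (fun n : ℕ+ => (n : ℕ)) + 1
  let g : ℕ → ℝ≥0∞ := fun n => ENNReal.ofReal (Real.log n ^ p / (n : ℝ) ^ (2 - 2 * p)) *
    Vilenkin.hardyNorm p (Vilenkin.regular (Vilenkin.rieszMean f n)) ^ p
  have hsub : s.map ⟨((↑) : ℕ+ → ℕ), PNat.coe_injective⟩ ⊆ Finset.Ico 1 R := by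
    intro n hn
    obtain ⟨k, hk, rfl⟩ := Finset.mem_map.1 hn
    have h1 : (k : ℕ) ≤ s.sup (fun n : ℕ+ => (n : ℕ)) :=
      Finset.le_sup (f := fun n : ℕ+ => (n : ℕ)) hk
    exact Finset.mem_Ico.2 ⟨k.2, Nat.lt_succ_of_le h1⟩
  calc _ = ∑ n ∈ s.map ⟨((↑) : ℕ+ → ℕ), PNat.coe_injective⟩, g n := by
        rw [Finset.sum_map]; rfl
    _ ≤ ∑ n ∈ Finset.Ico 1 R, g n := Finset.sum_le_sum_of_subset hsub
    _ ≤ ∑ n ∈ Finset.Ico 1 R, (ENNReal.ofReal ((n : ℝ) ^ (2 * p - 2)) *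
          ∫⁻ x, Vilenkin.rieszPow p n (f R) x ∂Vilenkin.haar m +
        ENNReal.ofReal (Vilenkin.l n ^ p * (n : ℝ) ^ (2 * p - 2)) * J) := by
        refine Finset.sum_le_sum fun n hn => ?_
        obtain ⟨h1, h2⟩ := Finset.mem_Ico.1 hn
        exact Vilenkin.term_le hm2 hp0 (by linarith) hf.1 h1
          (h2.le.trans (Vilenkin.lt_M hm2 R).le)
    _ = Vilenkin.weightedSum p R (f R) + ENNReal.ofReal
        (∑ n ∈ Finset.Ico 1 R, Vilenkin.l n ^ p * (n : ℝ) ^ (2 * p - 2)) * J := by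
        rw [Finset.sum_add_distrib, ← Finset.sum_mul, ENNReal.ofReal_sum_of_nonneg fun n _ =>
          mul_nonneg (Real.rpow_nonneg (Vilenkin.l_nonneg n) p) (by positivity)]
        rfl
    _ ≤ C₁ * J + ENNReal.ofReal C₂ * J := by
        gcongr
        · exact hC₁ m hm2 (fun k => (hm k).2) f hf.1 R R
        · exact hC₂ R
    _ = _ := by
        push_cast
        rw [add_mul]
        rfl
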